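/- Let $\sigma_0$ be a finite relational vocabulary all of whose symbols are unary or binary. Let $\mathscr C_0$ be a free amalgamation class of finite irreflexive $\sigma_0$-structures; that is, a nonempty class of finite $\sigma_0$-structures, closed under isomorphism and substructures, such that for all embeddings $X\to Y_1$, $X\to Y_2$ between members ($X$ may be empty) the free amalgam (the disjoint union of $Y_1$ and $Y_2$ over $X$, with no further relations) is again a member, and such that in every member $R(x,y)$ implies $x\neq y$ for each binary $R\in\sigma_0$. Let $\mathscr C$ be the class of all $(\sigma_0\uplus\{<\})$-structures obtained from members of $\mathscr C_0$ by interpreting $<$ as any strict total order, and let $\mathbb A$ be the (countable) Fraïssé limit of $\mathscr C$: $\mathbb A$ is homogeneous, and the finite structures that embed in it are exactly those in $\mathscr C$. Let $S\subset\mathbb A$ be a finite (possibly empty) set of named constants, and let $\operatorname{Aut}(\mathbb A/S)$ be the group of automorphisms of $\mathbb A$ that fix each element of $S$; it acts on each power $\mathbb A^k$ componentwise. "Equivariant" and "orbit" refer to this group (for $S=\emptyset$, to the full group $\operatorname{Aut}(\mathbb A)$). An orbit in $\mathbb A^k$ is called ordered if its tuples have entries outside $S$ and are strictly increasing. For a set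 $X$ and a vector space $E$ over a field $\mathbb F$, $\operatorname{Lin}_E X$ is the $\mathbb F$-space of finite formal linear combinations of elements of $X$ with coefficients in $E$, and $v(x)\in E$ is the coefficient of $x$ in $v$; a group acting on $X$ acts on $\operatorname{Lin}_E X$ by $\pi(\sum_i\lambda_i x_i)=\sum_i\lambda_i\,\pi(x_i)$. Let $\mathbb F$ be any field and $d\in\{1,2,\dots\}$. Then there is a finite family of equivariant $\mathbb F$-linear maps $$\restriction_i:\operatorname{Lin}_{\mathbb F}\mathbb A^d\to\operatorname{Lin}_{\mathbb F^{n_i}}\mathcal O_i ,\qquad n_i\in\mathbb N,$$ where $\mathcal O_i$ is an ordered orbit in $\mathbb A^{d_i}$ with $0\le d_i\leq d$, such that for every equivariant subspace $W\subseteq\operatorname{Lin}_{\mathbb F}\mathbb A^d$ the sets $$E_i=\{\,w{\restriction_i}(b)\mid w\in W,\ b\in\mathcal O_i\,\}\subseteq\mathbb F^{n_i}$$ are linear subspaces, and $$W=\{\,v\in\operatorname{Lin}_{\mathbb F}\mathbb A^d\mid \forall i,\ \forall a\in\mathcal O_i:\ v{\restriction_i}(a)\in E_i\,\}.$$ -/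

import Mathlib

open FirstOrder FirstOrder.Language CategoryTheory

universe u v w z

namespace OrderedFreeAmalgamation

/-! ### Free amalgamation classes -/

section Amalgamation

variable {L : FirstOrder.Language.{u, v}} {X Y₁ Y₂ Z : Type w}
  [L.Structure X] [L.Structure Y₁] [L.Structure Y₂] [L.Structure Z]

/-- `Z` is, via `g₁` and `g₂`, the free amalgam of `Y₁` and `Y₂` over `X` (relational vocabulary):
the underlying set of `Z` is the disjoint union of `Y₁` and `Y₂` over the common part `X`, and
there are no relations in `Z` besides those that hold inside `Y₁` or inside `Y₂`. -/
structure IsFreeAmalgam (f₁ : X ↪[L] Y₁) (f₂ : X ↪[L] Y₂) (g₁ : Y₁ ↪[L] Z) (g₂ : Y₂ ↪[L] Z) :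
    Prop where
  comm : ∀ x : X, g₁ (f₁ x) = g₂ (f₂ x)
  cover : ∀ z : Z, z ∈ Set.range g₁ ∨ z ∈ Set.range g₂
  inter : ∀ (y₁ : Y₁) (y₂ : Y₂), g₁ y₁ = g₂ y₂ → ∃ x : X, f₁ x = y₁ ∧ f₂ x = y₂
  rel : ∀ (n : ℕ) (R : L.Relations n) (z : Fin n → Z), Structure.RelMap R z →
    (∀ i, z i ∈ Set.range g₁) ∨ (∀ i, z i ∈ Set.range g₂)

end Amalgamation

/-- A free amalgamation class of finite structures: a nonempty class of finite structures, closed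
under isomorphism and substructures (`Hereditary`: every finitely generated structure embedding
in a member is a member), and closed under free amalgams. The amalgamation property, and joint
embedding as amalgamation over the empty structure, are special cases of the last condition. -/
structure IsFreeAmalgamationClass {L : FirstOrder.Language.{u, v}} (K : Set (Bundled.{w} L.Structure)) :
    Prop where
  nonempty : K.Nonempty
  finite : ∀ M : Bundled.{w} L.Structure, M ∈ K → Finite M
  hereditary : Hereditary K
  freeAmalgamation : ∀ (X Y₁ Y₂ : Bundled.{w} L.Structure) (f₁ : X ↪[L] Y₁) (f₂ : X ↪[L] Y₂),
    X ∈ K → Y₁ ∈ K → Y₂ ∈ K →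
      ∃ (Z : Bundled.{w} L.Structure) (g₁ : Y₁ ↪[L] Z) (g₂ : Y₂ ↪[L] Z),
        Z ∈ K ∧ IsFreeAmalgam f₁ f₂ g₁ g₂

/-- All structures of the class are irreflexive: `R(x, y)` implies `x ≠ y` for all binary `R`. -/
def IsIrreflexiveClass {L : FirstOrder.Language.{u, v}} (K : Set (Bundled.{w} L.Structure)) : Prop :=
  ∀ M : Bundled.{w} L.Structure, M ∈ K →
    ∀ (R : L.Relations 2) (x y : M), Structure.RelMap R ![x, y] → x ≠ y

/-! ### Ordered expansions -/

/-- The only relation symbol of the vocabulary `{<}`. -/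
inductive LtSymbol : ℕ → Type
  | lt : LtSymbol 2

/-- The vocabulary with a single, binary, relation symbol `<`. -/
def ltLanguage : FirstOrder.Language.{0, 0} := ⟨fun _ => Empty, LtSymbol⟩

instance : IsRelational ltLanguage := fun _ => inferInstanceAs (IsEmpty Empty)

/-- The vocabulary of `L` together with a new binary relation symbol `<`. -/
abbrev withLt (L : FirstOrder.Language.{u, v}) : FirstOrder.Language.{u, v} := L.sum ltLanguage

/-- The interpretation of the symbol `<`. -/
def ltRel (L : FirstOrder.Language.{u, v}) {A : Type w} [(withLt L).Structure A] (a b : A) : Prop :=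
  Structure.RelMap (L := withLt L) (Sum.inr LtSymbol.lt : (withLt L).Relations 2) ![a, b]

/-- All total orderings of all structures of `K`: the structures over the vocabulary with `<` whose
reduct to the old vocabulary belongs to `K` and in which `<` is a (strict) total order. -/
def orderedExpansions {L : FirstOrder.Language.{u, v}} (K : Set (Bundled.{w} L.Structure)) :
    Set (Bundled.{w} (withLt L).Structure) :=
  {M | (⟨M, (LHom.sumInl : L →ᴸ withLt L).reduct M⟩ : Bundled.{w} L.Structure) ∈ K ∧
    IsStrictTotalOrder M (ltRel L)}

/-! ### Automorphisms, orbits, equivariance -/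

/-- The group `Aut(A/S)` of those automorphisms of the structure `A` that fix every element
of `S`. As a group of permutations of `A`, it acts on every power `Fin d → A` componentwise. -/
def autFixing (L : FirstOrder.Language.{u, v}) (A : Type w) [L.Structure A] (S : Set A) :
    Subgroup (Equiv.Perm A) where
  carrier := {π | (∃ g : A ≃[L] A, ∀ a, π a = g a) ∧ ∀ s ∈ S, π s = s}
  mul_mem' := by
    rintro π ρ ⟨⟨g, hg⟩, hπ⟩ ⟨⟨h, hh⟩, hρ⟩
    refine ⟨⟨g.comp h, fun a => ?_⟩, fun s hs => ?_⟩
    · simp [hg, hh]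
    · simp [hρ s hs, hπ s hs]
  one_mem' := ⟨⟨FirstOrder.Language.Equiv.refl L A, fun _ => rfl⟩, fun _ _ => rfl⟩
  inv_mem' := by
    rintro π ⟨⟨g, hg⟩, hπ⟩
    refine ⟨⟨g.symm, fun a => ?_⟩, fun s hs => ?_⟩
    · rw [Equiv.Perm.inv_eq_iff_eq, hg, FirstOrder.Language.Equiv.apply_symm_apply]
    · rw [Equiv.Perm.inv_eq_iff_eq, hπ s hs]

/-- A tuple is `S`-ordered if its entries avoid `S` and are strictly increasing. -/
def IsOrderedTuple (L : FirstOrder.Language.{u, v}) {A : Type w} [(withLt L).Structure A] (S : Set A) {k : ℕ}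
    (a : Fin k → A) : Prop :=
  (∀ i, a i ∉ S) ∧ ∀ i j, i < j → ltRel L (a i) (a j)

section Lin

variable (F : Type*) [Field F] {G X : Type*} [Group G] [MulAction G X]
  (E : Type*) [AddCommGroup E] [Module F E]

/-- The space `Lin_E X` of finite formal linear combinations of elements of `X` with coefficients
in `E` is `X →₀ E`. This is the linear action of `g` on it: `∑ λᵢ xᵢ ↦ ∑ λᵢ (g xᵢ)`. -/
noncomputable def linAct (g : G) : (X →₀ E) →ₗ[F] (X →₀ E) :=
  Finsupp.lmapDomain E F (fun x => g • x)

end Lin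

/-- An equivariant subspace of `Lin_F X`. -/
def IsEquivariantSubspace {F : Type*} [Field F] (G : Type*) {X : Type*} [Group G] [MulAction G X]
    (W : Submodule F (X →₀ F)) : Prop :=
  ∀ g : G, ∀ w ∈ W, linAct F F g w ∈ W

/-- An equivariant linear map `Lin_F X → Lin_E Y`. -/
def IsEquivariantMap {F : Type*} [Field F] (G : Type*) {X Y : Type*} [Group G] [MulAction G X]
    [MulAction G Y] {E : Type*} [AddCommGroup E] [Module F E]
    (r : (X →₀ F) →ₗ[F] (Y →₀ E)) : Prop :=
  ∀ (g : G) (v : X →₀ F), r (linAct F F g v) = linAct F E g (r v)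

end OrderedFreeAmalgamation

open OrderedFreeAmalgamation

/-! For an orbit `P` of `A^d` and a selection `s` of `k` coordinates, `coord P s` keeps the part of
a vector on `P` and projects it along `s`. The restriction to an ordered orbit in `A^k`, `k ≤ d`,
bundles all these projections. By equivariance of `W`, its values form the same space `E` at every
tuple of the orbit. The point is that a vector `v` whose values all lie in these spaces belongs to
`W` (`mem_of_forall_coord`).

Elements of `W` are subtracted from `v` to clear its ordered coordinates, shorter lengths first.
Once those of length less than `k` vanish, the coefficients at an ordered orbit of length `k` form a
cycle: an `E`-valued vector killed by forgetting any one coordinate. Two facts finish the step. (1)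
Every cycle is a sum of cogs, alternating sums over the corners of a cube of tuples spanned by pairs
of unrelated twins `a₀ l`, `a₁ l` (`IsCycle.mem_closure_cogs`). (2) A cog with coefficient in `E`
lifts to `W` without lower ordered coordinates (`exists_coord_eq_cog`). Take `w ∈ W` with the given
value at `a₀`, and automorphisms `g I` carrying `a₀` to the corner `I` such that adding `l` to `I`
affects no point of `w` except `a₀ l`. In `∑ (-1)^|I| g I w` the contributions of tuples that miss
some `a₀ l` cancel in pairs. A vector with no ordered coordinates is zero (`eq_zero_of_coord`).

Fact (1) goes by induction on the active coordinates. Replacing the entries at `j` by unrelated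
twins changes a cycle by cogs, because each slice with a fixed `j`-th entry is a cycle with fewer
active coordinates. If a single point `x` is a twin of all `j`-th entries at once, the replacement
amounts to forgetting `j` and gives zero. To find such an `x`, the entries at the other coordinates
are first replaced by twins with so few relations that every clique of them looks like part of `o`,
and `j` is taken to be the least coordinate, so that `x` can be put below all of them. Free
amalgamation then yields `x`: a finite structure is in the class as soon as its cliques are. The
argument works over any abelian group of coefficients. -/

theorem Finsupp.filter_mapDomain_eq {α β M : Type*} [AddCommMonoid M] {f : α → β} {p : β → Prop}
    {q : α → Prop} [DecidablePred p] [DecidablePred q] (h : ∀ a, p (f a) ↔ q a) (v : α →₀ M) :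
    (v.mapDomain f).filter p = (v.filter q).mapDomain f := by
  induction v using Finsupp.induction_linear with
  | zero => rw [Finsupp.mapDomain_zero, Finsupp.filter_zero, Finsupp.filter_zero,
      Finsupp.mapDomain_zero]
  | add v w hv hw => simp only [Finsupp.mapDomain_add, Finsupp.filter_add, hv, hw]
  | single a m =>
    by_cases ha : q a
    · rw [Finsupp.mapDomain_single, Finsupp.filter_single_of_pos _ ((h a).2 ha),
        Finsupp.filter_single_of_pos _ ha, Finsupp.mapDomain_single]
    · rw [Finsupp.mapDomain_single, Finsupp.filter_single_of_neg _ (mt (h a).1 ha),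
        Finsupp.filter_single_of_neg _ ha, Finsupp.mapDomain_zero]

theorem Finsupp.sum_filter_eq_of_support {α β M : Type*} [AddCommMonoid M] [DecidableEq β]
    (f : α → β) (v : α →₀ M) :
    ∑ t ∈ v.support.image f, v.filter (fun a => f a = t) = v := by
  ext a
  rw [Finsupp.finsetSum_apply]
  simp only [Finsupp.filter_apply]
  by_cases ha : a ∈ v.support
  · rw [Finset.sum_eq_single (f a)]
    · simp
    · intro t _ ht
      rw [if_neg (Ne.symm ht)]
    · intro h
      exact absurd (Finset.mem_image_of_mem f ha) h
  · simp [Finsupp.notMem_support_iff.1 ha]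

/-! ### Generic colourings and atomic types. -/

/-- A linear order with a colouring of its points and of its pairs in which every one-point
extension whose cliques are realised is realised, in every cut of the order. -/
structure GenericColoring (A U Q : Type*) [LinearOrder A] where
  u : A → U
  c : A → A → Q
  nil : Q
  irrefl : ∀ p, c p p = nil
  ext : ∀ (B : Finset A) (ν : U) (f g : A → Q) (lo : A → Prop),
    (∀ b ∈ B, ∀ b' ∈ B, b < b' → lo b' → lo b) →
    -- It is enough that a copy of each clique, moved by `φ`, occurs somewhere; the order plays no
    -- role. For `K = ∅` this says that the colour `ν` occurs.
    (∀ K ⊆ B, (∀ b ∈ K, f b ≠ nil ∨ g b ≠ nil) →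
      (∀ b ∈ K, ∀ b' ∈ K, b ≠ b' → c b b' ≠ nil ∨ c b' b ≠ nil) →
      ∃ (y : A) (φ : A → A), u y = ν ∧ ∀ b ∈ K, u (φ b) = u b ∧ c y (φ b) = f b ∧
        c (φ b) y = g b ∧ ∀ b' ∈ K, b ≠ b' → c (φ b) (φ b') = c b b') →
    ∃ x ∉ B, u x = ν ∧ ∀ b ∈ B, c x b = f b ∧ c b x = g b ∧ (b < x ↔ lo b)

namespace GenericColoring

variable {A U Q : Type*} [LinearOrder A] (Γ : GenericColoring A U Q)

/-- The atomic type of a pair, without the colours of its points. -/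
def pair (p q : A) : Q × Q × Prop × Prop := (Γ.c p q, Γ.c q p, p < q, q < p)

variable {Γ}

theorem pair_eq_iff {p q p' q' : A} : Γ.pair p q = Γ.pair p' q' ↔
    Γ.c p q = Γ.c p' q' ∧ Γ.c q p = Γ.c q' p' ∧ (p < q ↔ p' < q') ∧ (q < p ↔ q' < p') := by
  simp [pair]

theorem pair_swap {p q p' q' : A} (h : Γ.pair p q = Γ.pair p' q') :
    Γ.pair q p = Γ.pair q' p' := by
  rw [pair_eq_iff] at h ⊢
  tauto

theorem pair_self (p p' : A) : Γ.pair p p = Γ.pair p' p' := by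
  simp [pair, Γ.irrefl]

theorem eq_iff_of_pair_eq {p q p' q' : A} (h : Γ.pair p q = Γ.pair p' q') :
    p = q ↔ p' = q' := by
  rw [pair_eq_iff] at h
  obtain ⟨-, -, h1, h2⟩ := h
  constructor
  · rintro rfl
    simp only [lt_self_iff_false, false_iff, not_lt] at h1 h2
    exact le_antisymm h2 h1
  · rintro rfl
    simp only [lt_self_iff_false, iff_false, not_lt] at h1 h2
    exact le_antisymm h2 h1

theorem pair_eq_of_ne {p q p' q' : A} (h : p ≠ q) (h' : p' ≠ q') (h1 : Γ.c p q = Γ.c p' q')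
    (h2 : Γ.c q p = Γ.c q' p') (h3 : p < q ↔ p' < q') : Γ.pair p q = Γ.pair p' q' := by
  rw [pair_eq_iff]
  refine ⟨h1, h2, h3, ?_⟩
  rw [← not_le, ← not_le, h.le_iff_lt, h'.le_iff_lt, h3]

variable (Γ)

/-- The tuples `a` and `o` have the same atomic type over `S`. -/
def SameType {ι : Type*} (S : Finset A) (o a : ι → A) : Prop :=
  ∀ i, Γ.u (a i) = Γ.u (o i) ∧ (∀ s ∈ S, Γ.pair (a i) s = Γ.pair (o i) s) ∧
    ∀ j, Γ.pair (a i) (a j) = Γ.pair (o i) (o j)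

variable {Γ}

section SameType

variable {ι : Type*} {S : Finset A} {o a : ι → A}

theorem SameType.apply_inj (h : Γ.SameType S o a) {i j : ι} : a i = a j ↔ o i = o j :=
  eq_iff_of_pair_eq ((h i).2.2 j)

theorem SameType.injective (h : Γ.SameType S o a) (ho : Function.Injective o) :
    Function.Injective a := fun _ _ hij => ho (h.apply_inj.1 hij)

theorem SameType.notMem (h : Γ.SameType S o a) {i : ι} (hi : o i ∉ S) : a i ∉ S := fun hs =>
  hi ((eq_iff_of_pair_eq ((h i).2.1 _ hs)).1 rfl ▸ hs)

end SameType

/-! ### Cogs, cycles, and replacement of one coordinate by twins. -/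

section Cog

variable {ι : Type*} [DecidableEq ι] {E : Type*} [AddCommGroup E]

/-- The alternating sum of the tuples in which the entries of `a₀` at some indices from `J`
are replaced by those of `a₁`. -/
noncomputable def cog (J : Finset ι) (a₀ a₁ : ι → A) (e : E) : (ι → A) →₀ E :=
  ∑ I ∈ J.powerset, (-1 : ℤ) ^ I.card • Finsupp.single (I.piecewise a₁ a₀) e

omit [LinearOrder A] in
theorem cog_insert {J : Finset ι} {j : ι} (hj : j ∉ J) (a₀ a₁ : ι → A) (x : A) (e : E) :
    cog (insert j J) a₀ (Function.update a₁ j x) e =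
      cog J a₀ a₁ e - (cog J a₀ a₁ e).mapDomain (fun a => Function.update a j x) := by
  have hI : ∀ I ∈ J.powerset, j ∉ I := fun I hI h => hj (Finset.mem_powerset.1 hI h)
  have hpw : ∀ I ∈ J.powerset, I.piecewise (Function.update a₁ j x) a₀ = I.piecewise a₁ a₀ := by
    intro I h
    exact Finset.piecewise_congr _ (fun i hi => by
      rw [Function.update_of_ne]; rintro rfl; exact hI _ h hi) (fun _ _ => rfl)
  rw [cog, Finset.sum_powerset_insert hj, sub_eq_add_neg]
  congr 1
  · exact Finset.sum_congr rfl fun I h => by rw [hpw I h]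
  · rw [cog, Finsupp.mapDomain_finsetSum, ← Finset.sum_neg_distrib]
    refine Finset.sum_congr rfl fun I h => ?_
    rw [Finset.card_insert_of_notMem (hI I h), Finset.piecewise_insert, hpw I h, pow_succ,
      Function.update_self, Finsupp.mapDomain_smul, Finsupp.mapDomain_single]
    simp

variable (Γ) in
/-- The cogs over `J` all of whose tuples have the type of `o` over `S`, built from twins that
are not related to each other. -/
def cogs (E : Type*) [AddCommGroup E] (S : Finset A) (o : ι → A) (J : Finset ι) :
    Set ((ι → A) →₀ E) :=
  {y | ∃ (a₀ a₁ : ι → A) (e : E), (∀ l ∉ J, a₀ l = o l) ∧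
    (∀ l ∈ J, Γ.c (a₀ l) (a₁ l) = Γ.nil ∧ Γ.c (a₁ l) (a₀ l) = Γ.nil ∧ a₀ l ≠ a₁ l) ∧
    (∀ I ⊆ J, Γ.SameType S o (I.piecewise a₁ a₀)) ∧ y = cog J a₀ a₁ e}

variable (Γ) in
/-- The vector `v` is supported on tuples of the type of `o` over `S` that agree with `o`
outside `J`, and is killed by forgetting any coordinate from `J`. -/
structure IsCycle (S : Finset A) (o : ι → A) (J : Finset ι) (v : (ι → A) →₀ E) : Prop where
  sameType : ∀ a ∈ v.support, Γ.SameType S o a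
  fixed : ∀ a ∈ v.support, ∀ j ∉ J, a j = o j
  forget : ∀ j ∈ J, ∀ p, v.mapDomain (fun a => Function.update a j p) = 0

/-- Forgetting a coordinate other than `j` does not touch the `j`-th entry, so it commutes with
slicing at `a j = t`. Types can be taken over `t` and `x` as well, since both `t` and its substitute
`x` stand to the other entries as `o j` does. -/
theorem IsCycle.of_sum {S : Finset A} {o : ι → A} {J : Finset ι} {v : (ι → A) →₀ E}
    (hv : Γ.IsCycle S o J v) (hS : ∀ j ∈ J, o j ∉ S) (hJ : ∀ j ∉ J, o j ∈ S)
    (ho : Function.Injective o) {j : ι} (hj : j ∈ J) {t x : A}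
    (hx : ∀ a ∈ v.support, a j = t → Γ.SameType S o (Function.update a j x))
    {a : ι → A} (ha : a ∈ v.support) (haj : a j = t) :
    (∀ i ∈ J.erase j, a i ∉ insert t (insert x S)) ∧ (∀ i ∉ J.erase j, a i ∈ insert t (insert x S)) ∧
      Γ.IsCycle (insert t (insert x S)) a (J.erase j) (v.filter (fun b => b j = t)) := by
  have hsa := hv.sameType a ha
  have hxa := hx a ha haj
  refine ⟨?_, ?_, ?_, ?_, ?_⟩
  · intro i hi
    obtain ⟨hij, hiJ⟩ := Finset.mem_erase.1 hi
    simp only [Finset.mem_insert, not_or]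
    refine ⟨?_, ?_, hsa.notMem (hS i hiJ)⟩
    · rw [← haj]
      exact fun h => hij (hsa.injective ho h)
    · intro h
      refine hij (hxa.injective ho (a₁ := i) (a₂ := j) ?_)
      simp [hij, h]
  · intro i hi
    by_cases hij : i = j
    · subst hij; simp [haj]
    · have : i ∉ J := fun h => hi (Finset.mem_erase.2 ⟨hij, h⟩)
      simp [hv.fixed a ha i this, hJ i this]
  · intro b hb
    rw [Finsupp.support_filter, Finset.mem_filter] at hb
    obtain ⟨hb, hbj⟩ := hb
    have hsb := hv.sameType b hb
    have hxb := hx b hb hbj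
    intro i
    refine ⟨(hsb i).1.trans (hsa i).1.symm, ?_, fun l => ((hsb i).2.2 l).trans ((hsa i).2.2 l).symm⟩
    intro s hs
    simp only [Finset.mem_insert] at hs
    rcases hs with rfl | rfl | hs
    · have := ((hsb i).2.2 j).trans ((hsa i).2.2 j).symm
      rwa [hbj, haj] at this
    · by_cases hij : i = j
      · subst hij; rw [hbj, haj]
      · have := ((hxb i).2.2 j).trans ((hxa i).2.2 j).symm
        simpa [hij] using this
    · exact ((hsb i).2.1 s hs).trans ((hsa i).2.1 s hs).symm
  · intro b hb i hi
    rw [Finsupp.support_filter, Finset.mem_filter] at hb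
    by_cases hij : i = j
    · subst hij; rw [hb.2, haj]
    · have : i ∉ J := fun h => hi (Finset.mem_erase.2 ⟨hij, h⟩)
      rw [hv.fixed a ha i this, hv.fixed b hb.1 i this]
  · intro i hi p
    obtain ⟨hij, hiJ⟩ := Finset.mem_erase.1 hi
    have h0 := congrArg (Finsupp.filter (fun b : ι → A => b j = t)) (hv.forget i hiJ p)
    rw [Finsupp.filter_zero] at h0
    rw [← h0, Finsupp.filter_mapDomain_eq (q := fun b => b j = t)]
    intro b
    rw [Function.update_of_ne (Ne.symm hij)]

/-- The pair `t`, `x` serves as the twins at the new coordinate, and `cog_insert` turns the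
difference of a small cog and its copy into a cog over `J`. All corners have the type of `o` because
the small cog was built over a set containing `t` and `x`. -/
theorem sub_mapDomain_mem_closure_cogs {S : Finset A} {o : ι → A} {J : Finset ι} {j : ι}
    {t x : A} (hj : j ∈ J) {a : ι → A} (haj : a j = t) (hjx : Γ.c t x = Γ.nil) (hxj : Γ.c x t = Γ.nil)
    (htx : t ≠ x) (hao : ∀ i ∉ J, a i = o i)
    (ha : Γ.SameType S o a) (hax : Γ.SameType S o (Function.update a j x))
    {v : (ι → A) →₀ E}
    (hv : v ∈ AddSubgroup.closure (Γ.cogs E (insert t (insert x S)) a (J.erase j))) :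
    v - v.mapDomain (fun b => Function.update b j x) ∈ AddSubgroup.closure (Γ.cogs E S o J) := by
  let ψ : ((ι → A) →₀ E) →+ ((ι → A) →₀ E) :=
    AddMonoidHom.id _ - Finsupp.mapDomain.addMonoidHom (fun b => Function.update b j x)
  suffices h : AddSubgroup.closure (Γ.cogs E (insert t (insert x S)) a (J.erase j)) ≤
      (AddSubgroup.closure (Γ.cogs E S o J)).comap ψ from h hv
  rw [AddSubgroup.closure_le]
  rintro _ ⟨a₀, a₁, e, h₁, h₂, h₃, rfl⟩
  have hj' : j ∉ J.erase j := Finset.notMem_erase j J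
  have ha₀ : a₀ j = t := by rw [h₁ j hj', haj]
  refine AddSubgroup.subset_closure ⟨a₀, Function.update a₁ j x, e, ?_, ?_, ?_, ?_⟩
  · intro l hl
    rw [h₁ l (fun h => hl (Finset.mem_of_mem_erase h)), hao l hl]
  · intro l hl
    by_cases hlj : l = j
    · subst hlj
      simp [ha₀, hjx, hxj, htx]
    · simpa [hlj] using h₂ l (Finset.mem_erase.2 ⟨hlj, hl⟩)
  · have key : ∀ I ⊆ J.erase j, Γ.SameType S o (I.piecewise a₁ a₀) ∧
        Γ.SameType S o (Function.update (I.piecewise a₁ a₀) j x) := by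
      intro I hI
      set b := I.piecewise a₁ a₀ with hb
      have hbj : b j = t := by
        rw [hb, Finset.piecewise_eq_of_notMem _ _ _ (fun h => hj' (hI h)), ha₀]
      have hsb := h₃ I hI
      rw [← hb] at hsb
      constructor
      · intro i
        exact ⟨(hsb i).1.trans (ha i).1,
          fun s hs => ((hsb i).2.1 s (by simp [hs])).trans ((ha i).2.1 s hs),
          fun l => ((hsb i).2.2 l).trans ((ha i).2.2 l)⟩
      · have hx : ∀ i, i ≠ j → Γ.pair (b i) x = Γ.pair (o i) (o j) := by
          intro i hij
          rw [(hsb i).2.1 x (by simp), ← (hax i).2.2 j]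
          simp [hij]
        intro i
        by_cases hij : i = j
        · subst hij
          refine ⟨?_, fun s hs => ?_, fun l => ?_⟩
          · rw [← (hax i).1]; simp
          · rw [← (hax i).2.1 s hs]; simp
          · by_cases hl : l = i
            · subst hl
              exact pair_self _ _
            · simpa [hl] using pair_swap (hx l hl)
        · refine ⟨?_, fun s hs => ?_, fun l => ?_⟩
          · rw [Function.update_of_ne hij]
            exact (hsb i).1.trans (ha i).1
          · rw [Function.update_of_ne hij]
            exact ((hsb i).2.1 s (by simp [hs])).trans ((ha i).2.1 s hs)
          · by_cases hl : l = j
            · subst hl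
              simpa [hij] using hx i hij
            · rw [Function.update_of_ne hij, Function.update_of_ne hl]
              exact ((hsb i).2.2 l).trans ((ha i).2.2 l)
    intro I hI
    by_cases hjI : j ∈ I
    · rw [← Finset.insert_erase hjI, Finset.piecewise_insert, Function.update_self]
      have := (key (I.erase j) (Finset.erase_subset_erase j hI)).2
      rwa [Finset.piecewise_congr (g := a₀) (g' := a₀) (f := Function.update a₁ j x) (f' := a₁)
        (I.erase j) (fun i hi => Function.update_of_ne (Finset.ne_of_mem_erase hi) _ _) (fun _ _ => rfl)]
    · have := (key I (fun i hi => Finset.mem_erase.2 ⟨fun h => hjI (h ▸ hi), hI hi⟩)).1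
      rwa [Finset.piecewise_congr (g := a₀) (g' := a₀) (f := Function.update a₁ j x) (f' := a₁)
        I (fun i hi => Function.update_of_ne (by rintro rfl; exact hjI hi) _ _) (fun _ _ => rfl)]
  · rw [← Finset.insert_erase hj, cog_insert hj', Finset.insert_erase hj]
    rfl

/-- Replacing the entries of a cycle at a coordinate `j` by unrelated twins changes it by a sum of
cogs, if this is known for cycles with fewer active coordinates. -/
theorem IsCycle.sub_mapDomain_mem {S : Finset A} {o : ι → A} {J : Finset ι} {v : (ι → A) →₀ E}
    (hv : Γ.IsCycle S o J v) (hS : ∀ j ∈ J, o j ∉ S) (hJ : ∀ j ∉ J, o j ∈ S)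
    (ho : Function.Injective o) {j : ι} (hj : j ∈ J)
    (IH : ∀ (S : Finset A) (o : ι → A) (v : (ι → A) →₀ E), (∀ i ∈ J.erase j, o i ∉ S) →
      (∀ i ∉ J.erase j, o i ∈ S) → Function.Injective o → Γ.IsCycle S o (J.erase j) v →
      v ∈ AddSubgroup.closure (Γ.cogs E S o (J.erase j)))
    (ρ : A → A)
    (hρ : ∀ a ∈ v.support, Γ.SameType S o (Function.update a j (ρ (a j))) ∧
      Γ.c (a j) (ρ (a j)) = Γ.nil ∧ Γ.c (ρ (a j)) (a j) = Γ.nil ∧ a j ≠ ρ (a j)) :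
    v - v.mapDomain (fun a => Function.update a j (ρ (a j))) ∈
      AddSubgroup.closure (Γ.cogs E S o J) := by
  have hsum := Finsupp.sum_filter_eq_of_support (fun a : ι → A => a j) v
  -- Split by the `j`-th entry: on each slice the replacement is by the constant `ρ t`.
  have : v - v.mapDomain (fun a => Function.update a j (ρ (a j))) =
      ∑ t ∈ v.support.image (fun a : ι → A => a j), (v.filter (fun a => a j = t) -
        (v.filter (fun a => a j = t)).mapDomain (fun a => Function.update a j (ρ t))) := by
    rw [Finset.sum_sub_distrib, hsum]
    congr 1
    conv_lhs => rw [← hsum]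
    rw [Finsupp.mapDomain_finsetSum]
    refine Finset.sum_congr rfl fun t _ => Finsupp.mapDomain_congr fun a ha => ?_
    rw [Finsupp.support_filter, Finset.mem_filter] at ha
    rw [ha.2]
  rw [this]
  refine AddSubgroup.sum_mem _ fun t ht => ?_
  obtain ⟨a, ha, rfl⟩ := Finset.mem_image.1 ht
  obtain ⟨h₁, h₂, h₃, h₄⟩ := hρ a ha
  have hx : ∀ b ∈ v.support, b j = a j → Γ.SameType S o (Function.update b j (ρ (a j))) :=
    fun b hb hba => hba ▸ (hρ b hb).1
  obtain ⟨k₁, k₂, k₃⟩ := hv.of_sum hS hJ ho hj hx ha rfl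
  exact sub_mapDomain_mem_closure_cogs hj rfl h₂ h₃ h₄ (hv.fixed a ha) (hv.sameType a ha) h₁
    (IH _ _ _ k₁ k₂ ((hv.sameType a ha).injective ho) k₃)

/-- Forgetting `j` also forgets the replacement. Forgetting another coordinate commutes with it, as
the new entry depends only on the old `j`-th entry. -/
theorem IsCycle.mapDomain_update {S : Finset A} {o : ι → A} {J : Finset ι} {v : (ι → A) →₀ E}
    (hv : Γ.IsCycle S o J v) {j : ι} (hj : j ∈ J) (ρ : A → A)
    (hρ : ∀ a ∈ v.support, Γ.SameType S o (Function.update a j (ρ (a j)))) :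
    Γ.IsCycle S o J (v.mapDomain (fun a => Function.update a j (ρ (a j)))) := by
  have hsupp : ∀ b ∈ (v.mapDomain (fun a => Function.update a j (ρ (a j)))).support,
      ∃ a ∈ v.support, Function.update a j (ρ (a j)) = b := fun b hb => by
    classical
    simpa using Finsupp.mapDomain_support hb
  refine ⟨?_, ?_, ?_⟩
  · intro b hb
    obtain ⟨a, ha, rfl⟩ := hsupp b hb
    exact hρ a ha
  · intro b hb i hi
    obtain ⟨a, ha, rfl⟩ := hsupp b hb
    rw [Function.update_of_ne (by rintro rfl; exact hi hj)]
    exact hv.fixed a ha i hi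
  · intro i hi p
    rw [← Finsupp.mapDomain_comp]
    by_cases hij : i = j
    · subst hij
      convert hv.forget i hi p using 2
      ext a : 1
      simp
    · have : (fun a : ι → A => Function.update a i p) ∘ (fun a => Function.update a j (ρ (a j))) =
          (fun a => Function.update a j (ρ (a j))) ∘ (fun a => Function.update a i p) := by
        ext a : 1
        simp only [Function.comp]
        rw [Function.update_comm (Ne.symm hij), Function.update_of_ne (Ne.symm hij)]
      rw [this, Finsupp.mapDomain_comp, hv.forget i hi p, Finsupp.mapDomain_zero]

end Cog
end GenericColoring

/-! ### Cycles are sums of cogs. -/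

namespace GenericColoring

variable {A U Q : Type*} [LinearOrder A] {Γ : GenericColoring A U Q}

/-- Simultaneous twins of the points of `T`, immediately below them, where only the prescribed
relations to `B` are kept. -/
theorem exists_twins (Γ : GenericColoring A U Q) (B : Finset A) (N : A → Set A) (T : Finset A) :
    ∃ ρ : A → A, ∀ t ∈ T, ρ t ∉ B ∧ Γ.u (ρ t) = Γ.u t ∧
      (∀ b ∈ B, (b ∈ N t → Γ.c (ρ t) b = Γ.c t b ∧ Γ.c b (ρ t) = Γ.c b t) ∧
        (b ∉ N t → Γ.c (ρ t) b = Γ.nil ∧ Γ.c b (ρ t) = Γ.nil) ∧ (b < ρ t ↔ b < t)) ∧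
      ∀ t' ∈ T, Γ.c (ρ t) (ρ t') = Γ.nil := by
  classical
  induction T using Finset.induction_on with
  | empty => exact ⟨id, by simp⟩
  | insert t T ht ih =>
    obtain ⟨ρ, hρ⟩ := ih
    let M : Set A := {b | b ∈ B ∧ b ∈ N t}
    obtain ⟨x, hxB, hxu, hx⟩ := Γ.ext (B ∪ T.image ρ) (Γ.u t)
      (fun b => if b ∈ M then Γ.c t b else Γ.nil) (fun b => if b ∈ M then Γ.c b t else Γ.nil)
      (fun b => b < t) (fun b _ b' _ h h' => h.trans h') (by
        -- A point related to the new one lies in `M`, so `t` itself, with the identity on `K`,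
        -- realises the clique.
        intro K _ hK _
        refine ⟨t, id, rfl, fun b hb => ?_⟩
        have hbM : b ∈ M := by
          by_contra h
          have := hK b hb
          simp [h] at this
        simp [hbM])
    rw [Finset.mem_union, not_or] at hxB
    have hne : ∀ s ∈ T, s ≠ t := fun s hs h => ht (h ▸ hs)
    have hnil : ∀ s ∈ T, Γ.c x (ρ s) = Γ.nil ∧ Γ.c (ρ s) x = Γ.nil := by
      intro s hs
      have h1 := hx (ρ s) (Finset.mem_union_right _ (Finset.mem_image_of_mem ρ hs))
      have h2 : ρ s ∉ M := fun h => (hρ s hs).1 h.1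
      simp only [h2, if_false] at h1
      exact ⟨h1.1, h1.2.1⟩
    refine ⟨Function.update ρ t x, ?_⟩
    intro s hs
    rcases Finset.mem_insert.1 hs with rfl | hsT
    · rw [Function.update_self]
      refine ⟨hxB.1, hxu, fun b hb => ?_, fun t' ht' => ?_⟩
      · have h1 := hx b (Finset.mem_union_left _ hb)
        refine ⟨fun h => ?_, fun h => ?_, h1.2.2⟩
        · have : b ∈ M := ⟨hb, h⟩
          simp only [this, if_true] at h1
          exact ⟨h1.1, h1.2.1⟩
        · have : b ∉ M := fun h' => h h'.2
          simp only [this, if_false] at h1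
          exact ⟨h1.1, h1.2.1⟩
      · rcases Finset.mem_insert.1 ht' with rfl | htT
        · rw [Function.update_self, Γ.irrefl]
        · rw [Function.update_of_ne (hne _ htT)]
          exact (hnil _ htT).1
    · rw [Function.update_of_ne (hne _ hsT)]
      refine ⟨(hρ s hsT).1, (hρ s hsT).2.1, (hρ s hsT).2.2.1, fun t' ht' => ?_⟩
      rcases Finset.mem_insert.1 ht' with rfl | htT
      · rw [Function.update_self]
        exact (hnil _ hsT).2
      · rw [Function.update_of_ne (hne _ htT)]
        exact (hρ s hsT).2.2.2 t' htT

variable {ι : Type*} [DecidableEq ι] {E : Type*} [AddCommGroup E]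

/-- In the support of `v`, the entries at coordinates from `M` are entries at no other coordinate
from `J`, and two such entries are unrelated unless they are related like the entries of `o`. -/
def RolesSeparated (Γ : GenericColoring A U Q) (o : ι → A) (J M : Finset ι) (v : (ι → A) →₀ E) :
    Prop :=
  ∀ i ∈ M, ∀ a ∈ v.support, ∀ a' ∈ v.support, (∀ i' ∈ J, i' ≠ i → a i ≠ a' i') ∧
    Γ.c (a i) (a' i) = Γ.nil ∧ ∀ i' ∈ M, i' ≠ i →
      (Γ.c (a i) (a' i') = Γ.nil ∧ Γ.c (a' i') (a i) = Γ.nil) ∨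
      (Γ.c (a i) (a' i') = Γ.c (o i) (o i') ∧ Γ.c (a' i') (a i) = Γ.c (o i') (o i))

/-- The twin of a `j`-th entry `t` keeps its relations to `S` and to those entries of other active
coordinates that are related to `t` as in `o`. This suffices for every tuple to keep its type. All
other relations are dropped, and the twins are new points unrelated to each other. -/
theorem IsCycle.exists_rolesSeparated_insert [Fintype ι] {S : Finset A} {o : ι → A} {J M : Finset ι}
    {v : (ι → A) →₀ E} (hv : Γ.IsCycle S o J v) (hS : ∀ j ∈ J, o j ∉ S) (hJ : ∀ j ∉ J, o j ∈ S)
    (ho : Function.Injective o) {j : ι} (hj : j ∈ J) (hjM : j ∉ M) (hMJ : M ⊆ J)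
    (hsep : Γ.RolesSeparated o J M v)
    (IH : ∀ (S : Finset A) (o : ι → A) (v : (ι → A) →₀ E), (∀ i ∈ J.erase j, o i ∉ S) →
      (∀ i ∉ J.erase j, o i ∈ S) → Function.Injective o → Γ.IsCycle S o (J.erase j) v →
      v ∈ AddSubgroup.closure (Γ.cogs E S o (J.erase j))) :
    ∃ v', v - v' ∈ AddSubgroup.closure (Γ.cogs E S o J) ∧ Γ.IsCycle S o J v' ∧
      Γ.RolesSeparated o J (insert j M) v' := by
  classical
  let B : Finset A := S ∪ v.support.biUnion (fun a => Finset.univ.image a)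
  have hB : ∀ a ∈ v.support, ∀ i, a i ∈ B := fun a ha i =>
    Finset.mem_union_right _ (Finset.mem_biUnion.2 ⟨a, ha, Finset.mem_image_of_mem a (Finset.mem_univ i)⟩)
  have hSB : ∀ s ∈ S, s ∈ B := fun s hs => Finset.mem_union_left _ hs
  let N : A → Set A := fun t => {b | b ∈ S ∨ ∃ i ∈ J, i ≠ j ∧ ∃ a ∈ v.support, b = a i ∧
    Γ.c t b = Γ.c (o j) (o i) ∧ Γ.c b t = Γ.c (o i) (o j)}
  obtain ⟨ρ, hρ⟩ := Γ.exists_twins B N (v.support.image (fun a => a j))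
  replace hρ := fun a ha => hρ (a j) (Finset.mem_image_of_mem (fun a : ι → A => a j) (a := a) ha)
  have hne : ∀ a ∈ v.support, ∀ b ∈ B, ρ (a j) ≠ b := fun a ha b hb h => (hρ a ha).1 (h ▸ hb)
  have hpair : ∀ a ∈ v.support, ∀ b ∈ B, b ≠ a j → b ∈ N (a j) →
      Γ.pair (ρ (a j)) b = Γ.pair (a j) b := by
    intro a ha b hb hba hbN
    obtain ⟨h1, -, h2⟩ := (hρ a ha).2.2.1 b hb
    exact pair_swap (pair_eq_of_ne (hne a ha b hb).symm hba (h1 hbN).2 (h1 hbN).1 h2)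
  have hother : ∀ a ∈ v.support, ∀ i, i ≠ j → Γ.pair (ρ (a j)) (a i) = Γ.pair (o j) (o i) := by
    intro a ha i hij
    have hsa := hv.sameType a ha
    have hp := (hsa j).2.2 i
    rw [← hp]
    refine hpair a ha _ (hB a ha i) (fun h => hij (hsa.injective ho h)) ?_
    by_cases hi : i ∈ J
    · have := pair_eq_iff.1 hp
      exact Or.inr ⟨i, hi, hij, a, ha, rfl, this.1, this.2.1⟩
    · exact Or.inl (hv.fixed a ha i hi ▸ hJ i hi)
  have hupd : ∀ a ∈ v.support, Γ.SameType S o (Function.update a j (ρ (a j))) := by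
    intro a ha i
    have hsa := hv.sameType a ha
    by_cases hij : i = j
    · subst hij
      rw [Function.update_self]
      refine ⟨(hρ a ha).2.1.trans (hsa i).1, fun s hs => ?_, fun l => ?_⟩
      · rw [← (hsa i).2.1 s hs]
        exact hpair a ha s (hSB s hs) (fun h => hsa.notMem (hS i hj) (h ▸ hs)) (Or.inl hs)
      · by_cases hl : l = i
        · subst hl
          rw [Function.update_self]
          exact pair_self (Γ := Γ) _ _
        · rw [Function.update_of_ne hl]
          exact hother a ha l hl
    · rw [Function.update_of_ne hij]
      refine ⟨(hsa i).1, (hsa i).2.1, fun l => ?_⟩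
      by_cases hl : l = j
      · subst hl
        rw [Function.update_self]
        exact pair_swap (hother a ha i hij)
      · rw [Function.update_of_ne hl]
        exact (hsa i).2.2 l
  have hrel : ∀ a ∈ v.support, ∀ b ∈ B, Γ.c (ρ (a j)) b = Γ.nil ∧ Γ.c b (ρ (a j)) = Γ.nil ∨
      b ∈ N (a j) ∧ Γ.c (ρ (a j)) b = Γ.c (a j) b ∧ Γ.c b (ρ (a j)) = Γ.c b (a j) := by
    intro a ha b hb
    obtain ⟨h1, h2, -⟩ := (hρ a ha).2.2.1 b hb
    by_cases h : b ∈ N (a j)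
    · exact Or.inr ⟨h, h1 h⟩
    · exact Or.inl (h2 h)
  have hcross : ∀ a ∈ v.support, ∀ a' ∈ v.support, ∀ i ∈ M,
      (Γ.c (ρ (a j)) (a' i) = Γ.nil ∧ Γ.c (a' i) (ρ (a j)) = Γ.nil) ∨
      (Γ.c (ρ (a j)) (a' i) = Γ.c (o j) (o i) ∧ Γ.c (a' i) (ρ (a j)) = Γ.c (o i) (o j)) := by
    intro a ha a' ha' i hi
    rcases hrel a ha (a' i) (hB a' ha' i) with h | ⟨hN, h1, h2⟩
    · exact Or.inl h
    · right
      rw [h1, h2]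
      -- An entry at `i ∈ M` occurs at no other active coordinate, so the relation that was kept is
      -- the one prescribed for `i`.
      rcases hN with hN | ⟨i', hi', -, b, hb, hb', h3⟩
      · exact absurd hN ((hv.sameType a' ha').notMem (hS i (hMJ hi)))
      · by_cases hii : i' = i
        · subst hii
          exact h3
        · exact absurd hb' ((hsep i hi a' ha' b hb).1 i' hi' hii)
  refine ⟨_, hv.sub_mapDomain_mem hS hJ ho hj IH ρ fun a ha => ⟨hupd a ha, ?_, ?_,
    (hne a ha _ (hB a ha j)).symm⟩, hv.mapDomain_update hj ρ hupd, ?_⟩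
  · rcases hrel a ha (a j) (hB a ha j) with h | ⟨-, -, h⟩
    · exact h.2
    · rw [h, Γ.irrefl]
  · rcases hrel a ha (a j) (hB a ha j) with h | ⟨-, h, -⟩
    · exact h.1
    · rw [h, Γ.irrefl]
  · intro i hi b hb b' hb'
    have hsupp : ∀ b ∈ (v.mapDomain (fun a => Function.update a j (ρ (a j)))).support,
        ∃ a ∈ v.support, Function.update a j (ρ (a j)) = b := fun b hb => by
      simpa using Finsupp.mapDomain_support hb
    obtain ⟨a, ha, rfl⟩ := hsupp b hb
    obtain ⟨a', ha', rfl⟩ := hsupp b' hb'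
    by_cases hij : i = j
    · subst hij
      rw [Function.update_self, Function.update_self]
      refine ⟨fun i' _ hii => ?_, (hρ a ha).2.2.2 _ (Finset.mem_image_of_mem (fun a : ι → A => a i) ha'),
        fun i' hi' hii => ?_⟩
      · rw [Function.update_of_ne hii]
        exact hne a ha _ (hB a' ha' i')
      · rw [Function.update_of_ne hii]
        exact hcross a ha a' ha' i' ((Finset.mem_insert.1 hi').resolve_left hii)
    · have hiM := (Finset.mem_insert.1 hi).resolve_left hij
      have hold := hsep i hiM a ha a' ha'
      rw [Function.update_of_ne hij, Function.update_of_ne hij]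
      refine ⟨fun i' hi' hii => ?_, hold.2.1, fun i' hi' hii => ?_⟩
      · by_cases h : i' = j
        · subst h
          rw [Function.update_self]
          exact (hne a' ha' _ (hB a ha i)).symm
        · rw [Function.update_of_ne h]
          exact hold.1 i' hi' hii
      · by_cases h : i' = j
        · subst h
          rw [Function.update_self]
          have := hcross a' ha' a ha i hiM
          tauto
        · rw [Function.update_of_ne h]
          exact hold.2.2 i' ((Finset.mem_insert.1 hi').resolve_left h) hii

theorem IsCycle.exists_rolesSeparated [Fintype ι] {S : Finset A} {o : ι → A} {J : Finset ι}
    {v : (ι → A) →₀ E} (hv : Γ.IsCycle S o J v) (hS : ∀ j ∈ J, o j ∉ S) (hJ : ∀ j ∉ J, o j ∈ S)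
    (ho : Function.Injective o)
    (IH : ∀ j ∈ J, ∀ (S : Finset A) (o : ι → A) (v : (ι → A) →₀ E), (∀ i ∈ J.erase j, o i ∉ S) →
      (∀ i ∉ J.erase j, o i ∈ S) → Function.Injective o → Γ.IsCycle S o (J.erase j) v →
      v ∈ AddSubgroup.closure (Γ.cogs E S o (J.erase j))) (M : Finset ι) (hM : M ⊆ J) :
    ∃ v', v - v' ∈ AddSubgroup.closure (Γ.cogs E S o J) ∧ Γ.IsCycle S o J v' ∧
      Γ.RolesSeparated o J M v' := by
  induction M using Finset.induction_on with
  | empty => exact ⟨v, by simp, hv, by simp [RolesSeparated]⟩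
  | insert j M hjM ih =>
    obtain ⟨v', h1, h2, h3⟩ := ih (fun i hi => hM (Finset.mem_insert_of_mem hi))
    have hj := hM (Finset.mem_insert_self j M)
    obtain ⟨v'', k1, k2⟩ := h2.exists_rolesSeparated_insert hS hJ ho hj hjM
      (fun i hi => hM (Finset.mem_insert_of_mem hi)) h3 (IH j hj)
    exact ⟨v'', by simpa using add_mem h1 k1, k2⟩

/-- One point `x` replaces the `j`-th entries of all tuples in the support. It is to be related to
each entry at `i` as `o j` is to `o i`; this is consistent because each entry has only one role. A
clique collapses onto entries of `o` and constants with its colours intact, so next to `o j` it is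
already realised. -/
theorem IsCycle.mem_closure_of_rolesSeparated [Fintype ι] {S : Finset A} {o : ι → A} {J : Finset ι}
    {v : (ι → A) →₀ E} (hv : Γ.IsCycle S o J v) (hS : ∀ j ∈ J, o j ∉ S) (hJ : ∀ j ∉ J, o j ∈ S)
    (ho : Function.Injective o) {j : ι} (hj : j ∈ J) (hmin : ∀ i ∈ J, o j ≤ o i)
    (hsep : Γ.RolesSeparated o J (J.erase j) v)
    (IH : ∀ (S : Finset A) (o : ι → A) (v : (ι → A) →₀ E), (∀ i ∈ J.erase j, o i ∉ S) →
      (∀ i ∉ J.erase j, o i ∈ S) → Function.Injective o → Γ.IsCycle S o (J.erase j) v →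
      v ∈ AddSubgroup.closure (Γ.cogs E S o (J.erase j))) :
    v ∈ AddSubgroup.closure (Γ.cogs E S o J) := by
  classical
  let B : Finset A := S ∪ v.support.biUnion (fun a => Finset.univ.image a)
  have hB : ∀ a ∈ v.support, ∀ i, a i ∈ B := fun a ha i =>
    Finset.mem_union_right _ (Finset.mem_biUnion.2 ⟨a, ha, Finset.mem_image_of_mem a (Finset.mem_univ i)⟩)
  have hSB : ∀ s ∈ S, s ∈ B := fun s hs => Finset.mem_union_left _ hs
  -- `φ` collapses every entry onto the entry of `o` at the same coordinate
  let P : A → ι → Prop := fun b i => i ∈ J.erase j ∧ ∃ a ∈ v.support, a i = b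
  have hPS : ∀ b i, P b i → b ∉ S := by
    rintro _ i ⟨hi, a, ha, rfl⟩
    exact (hv.sameType a ha).notMem (hS i (Finset.mem_of_mem_erase hi))
  have hPuniq : ∀ b i i', P b i → P b i' → i = i' := by
    rintro _ i i' ⟨hi, a, ha, rfl⟩ ⟨hi', a', ha', h⟩
    by_contra hne
    exact (hsep i hi a ha a' ha').1 i' (Finset.mem_of_mem_erase hi') (Ne.symm hne) h.symm
  let φ : A → A := fun b => if h : ∃ i, P b i then o h.choose else b
  have hφP : ∀ b i, P b i → φ b = o i := by
    intro b i h
    have h' : ∃ i, P b i := ⟨i, h⟩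
    simp only [φ, dif_pos h']
    rw [hPuniq b _ i h'.choose_spec h]
  have hφS : ∀ b ∈ S, φ b = b := by
    intro b hb
    have h' : ¬ ∃ i, P b i := fun ⟨i, h⟩ => hPS b i h hb
    simp only [φ, dif_neg h']
  let R : Set A := {b | b ∈ S ∨ ∃ i, P b i}
  obtain ⟨x, hxB, hxu, hx⟩ := Γ.ext B (Γ.u (o j))
    (fun b => if b ∈ R then Γ.c (o j) (φ b) else Γ.nil)
    (fun b => if b ∈ R then Γ.c (φ b) (o j) else Γ.nil)
    -- The new point goes just above the constants below `o j`. As `o j` is least among the active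
    -- entries of `o`, the entries at the other active coordinates exceed these constants and end up
    -- above `x`.
    (fun b => ∃ s ∈ S, s < o j ∧ b ≤ s) (by
      rintro b - b' - h ⟨s, hs, h1, h2⟩
      exact ⟨s, hs, h1, h.le.trans h2⟩) (by
      intro K hKB hK hKc
      have hKR : ∀ b ∈ K, b ∈ R := by
        intro b hb
        by_contra h
        have := hK b hb
        simp [h] at this
      refine ⟨o j, φ, rfl, fun b hb => ⟨?_, ?_, ?_, fun b' hb' hbb => ?_⟩⟩
      · rcases hKR b hb with h | ⟨i, h⟩
        · rw [hφS b h]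
        · rw [hφP b i h]
          obtain ⟨-, a, ha, rfl⟩ := h
          exact (hv.sameType a ha i).1.symm
      · simp [hKR b hb]
      · simp [hKR b hb]
      · rcases hKR b hb with h | ⟨i, h⟩ <;> rcases hKR b' hb' with h' | ⟨i', h'⟩
        · rw [hφS b h, hφS b' h']
        · rw [hφS b h, hφP b' i' h']
          obtain ⟨-, a, ha, rfl⟩ := h'
          exact (pair_eq_iff.1 ((hv.sameType a ha i').2.1 b h)).2.1.symm
        · rw [hφS b' h', hφP b i h]
          obtain ⟨-, a, ha, rfl⟩ := h
          exact (pair_eq_iff.1 ((hv.sameType a ha i).2.1 b' h')).1.symm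
        · rw [hφP b i h, hφP b' i' h']
          have hrel := hKc b hb b' hb' hbb
          obtain ⟨hi, a, ha, rfl⟩ := h
          obtain ⟨hi', a', ha', rfl⟩ := h'
          have h1 := hsep i hi a ha a' ha'
          -- Two entries of the same coordinate are unrelated, so no clique contains both; related
          -- entries of different coordinates are related as in `o`.
          by_cases hii : i' = i
          · subst hii
            have h2 := hsep i' hi a' ha' a ha
            exact absurd hrel (by simp [h1.2.1, h2.2.1])
          · rcases h1.2.2 i' hi' hii with h3 | h3
            · exact absurd hrel (by simp [h3.1, h3.2])
            · exact h3.1.symm)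
  have hxne : ∀ b ∈ B, b ≠ x := fun b hb h => hxB (h ▸ hb)
  have hxS : ∀ s ∈ S, Γ.pair x s = Γ.pair (o j) s := by
    intro s hs
    obtain ⟨h1, h2, h3⟩ := hx s (hSB s hs)
    have hR : s ∈ R := Or.inl hs
    simp only [hR, if_true, hφS s hs] at h1 h2
    refine pair_swap (pair_eq_of_ne (hxne s (hSB s hs)) (fun h => hS j hj (h ▸ hs)) h2 h1 ?_)
    rw [h3]
    exact ⟨fun ⟨s', _, h, h'⟩ => h'.trans_lt h, fun h => ⟨s, hs, h, le_rfl⟩⟩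
  have hxP : ∀ b i, P b i → Γ.pair x b = Γ.pair (o j) (o i) := by
    intro b i h
    have hR : b ∈ R := Or.inr ⟨i, h⟩
    have hφ := hφP b i h
    obtain ⟨hi, a, ha, rfl⟩ := h
    obtain ⟨h1, h2, h3⟩ := hx (a i) (hB a ha i)
    simp only [hR, if_true, hφ] at h1 h2
    obtain ⟨hij, hiJ⟩ := Finset.mem_erase.1 hi
    refine pair_swap (pair_eq_of_ne (hxne _ (hB a ha i)) (fun h => hij (ho h)) h2 h1 ?_)
    rw [h3]
    refine ⟨?_, fun h => absurd (hmin i hiJ) (not_le.2 h)⟩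
    rintro ⟨s, hs, h4, h5⟩
    have h6 := pair_eq_iff.1 ((hv.sameType a ha i).2.1 s hs)
    have h7 : a i ≠ s := fun h => (hv.sameType a ha).notMem (hS i hiJ) (h ▸ hs)
    exact (h6.2.2.1.1 (lt_of_le_of_ne h5 h7)).trans h4
  have hother : ∀ a ∈ v.support, ∀ i, i ≠ j → Γ.pair x (a i) = Γ.pair (o j) (o i) := by
    intro a ha i hij
    by_cases hi : i ∈ J
    · exact hxP _ i ⟨Finset.mem_erase.2 ⟨hij, hi⟩, a, ha, rfl⟩
    · rw [hv.fixed a ha i hi]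
      exact hxS _ (hJ i hi)
  have hnil : ∀ a ∈ v.support, Γ.c x (a j) = Γ.nil ∧ Γ.c (a j) x = Γ.nil := by
    intro a ha
    have hR : a j ∉ R := by
      rintro (h | ⟨i, hi, a', ha', h⟩)
      · exact (hv.sameType a ha).notMem (hS j hj) h
      · exact (hsep i hi a' ha' a ha).1 j hj (Finset.ne_of_mem_erase hi).symm h
    have h1 := hx (a j) (hB a ha j)
    simp only [hR, if_false] at h1
    exact ⟨h1.1, h1.2.1⟩
  have h := hv.sub_mapDomain_mem hS hJ ho hj IH (fun _ => x) (fun a ha => by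
    refine ⟨?_, (hnil a ha).2, (hnil a ha).1, hxne _ (hB a ha j)⟩
    have hsa := hv.sameType a ha
    intro i
    by_cases hij : i = j
    · subst hij
      rw [Function.update_self]
      refine ⟨hxu, hxS, fun l => ?_⟩
      by_cases hl : l = i
      · subst hl
        rw [Function.update_self]
        exact pair_self (Γ := Γ) _ _
      · rw [Function.update_of_ne hl]
        exact hother a ha l hl
    · rw [Function.update_of_ne hij]
      refine ⟨(hsa i).1, (hsa i).2.1, fun l => ?_⟩
      by_cases hl : l = j
      · subst hl
        rw [Function.update_self]
        exact pair_swap (hother a ha i hij)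
      · rw [Function.update_of_ne hl]
        exact (hsa i).2.2 l)
  -- Replacing by the constant `x` is forgetting `j`, which kills the cycle.
  rwa [hv.forget j hj x, sub_zero] at h

/-- Cycles are sums of cogs. -/
theorem IsCycle.mem_closure_cogs [Fintype ι] (J : Finset ι) : ∀ (S : Finset A) (o : ι → A)
    (v : (ι → A) →₀ E), (∀ j ∈ J, o j ∉ S) → (∀ j ∉ J, o j ∈ S) → Function.Injective o →
    Γ.IsCycle S o J v → v ∈ AddSubgroup.closure (Γ.cogs E S o J) := by
  induction J using Finset.strongInduction with
  | H J ih =>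
    intro S o v hS hJ ho hv
    have IH := fun j (hj : j ∈ J) => ih (J.erase j) (Finset.erase_ssubset hj)
    rcases J.eq_empty_or_nonempty with rfl | hne
    -- With no active coordinate, `v` is a multiple of `o`, which is a cog with one corner.
    · have ha : ∀ a ∈ v.support, a = o := fun a ha => funext fun i => hv.fixed a ha i (by simp)
      have hvo : v = Finsupp.single o (v o) := by
        ext a
        by_cases h : a = o
        · simp [h]
        · rw [Finsupp.single_apply, if_neg (Ne.symm h)]
          by_contra h'
          exact h (ha a (Finsupp.mem_support_iff.2 h'))
      by_cases h0 : v = 0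
      · rw [h0]
        exact zero_mem _
      refine AddSubgroup.subset_closure ⟨o, o, v o, by simp, by simp, fun I _ => ?_, ?_⟩
      · rw [Finset.piecewise_same]
        exact fun i => ⟨rfl, fun _ _ => rfl, fun _ => rfl⟩
      · simpa [cog] using hvo
    · obtain ⟨j, hj, hmin⟩ := J.exists_min_image o hne
      obtain ⟨v', h1, h2, h3⟩ := hv.exists_rolesSeparated hS hJ ho IH (J.erase j)
        (Finset.erase_subset j J)
      have := h2.mem_closure_of_rolesSeparated hS hJ ho hj hmin h3 (IH j hj)
      simpa using add_mem h1 this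

end GenericColoring

/-! ### Collapses, homogeneity, and independent movement of twins. -/

namespace GenericColoring

variable {A U Q : Type*} [LinearOrder A] {Γ : GenericColoring A U Q}

variable (Γ) in
/-- The map `φ` collapses `B`: it preserves colours, and points with equal images are unrelated. -/
def IsCollapse (B : Finset A) (φ : A → A) : Prop :=
  ∀ b ∈ B, Γ.u b = Γ.u (φ b) ∧ ∀ b' ∈ B, Γ.c b b' = Γ.c (φ b) (φ b') ∧ (b < b' → φ b ≤ φ b')

theorem IsCollapse.pair_eq {B : Finset A} {φ : A → A} (h : Γ.IsCollapse B φ) {b b' : A}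
    (hb : b ∈ B) (hb' : b' ∈ B) (hne : φ b ≠ φ b') : Γ.pair b b' = Γ.pair (φ b) (φ b') := by
  refine pair_eq_of_ne (fun h' => hne (h' ▸ rfl)) hne ((h b hb).2 b' hb').1 ((h b' hb').2 b hb).1 ?_
  refine ⟨fun h' => lt_of_le_of_ne (((h b hb).2 b' hb').2 h') hne, fun h' => ?_⟩
  by_contra hlt
  rcases (not_lt.1 hlt).eq_or_lt with h2 | h2
  · exact hne (h2 ▸ rfl)
  · exact absurd (((h b' hb').2 b hb).2 h2) (not_le.2 h')

/-- The new preimage copies the relations of `d` along `φ`. Cliques are no obstacle, since `d` and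
`φ` realise the whole configuration at once. -/
theorem IsCollapse.exists_insert {B : Finset A} {φ : A → A} (h : Γ.IsCollapse B φ) (d : A) :
    ∃ x ∉ B, Γ.IsCollapse (insert x B) (Function.update φ x d) := by
  obtain ⟨x, hxB, hxu, hx⟩ := Γ.ext B (Γ.u d) (fun b => Γ.c d (φ b)) (fun b => Γ.c (φ b) d)
    (fun b => φ b < d) (fun b hb b' hb' hlt h' => (((h b hb).2 b' hb').2 hlt).trans_lt h') (by
      intro K hKB _ _
      exact ⟨d, φ, rfl, fun b hb => ⟨((h b (hKB hb)).1).symm, rfl, rfl,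
        fun b' hb' _ => (((h b (hKB hb)).2 b' (hKB hb')).1).symm⟩⟩)
  refine ⟨x, hxB, ?_⟩
  have hne : ∀ b ∈ B, b ≠ x := fun b hb h => hxB (h ▸ hb)
  intro b hb
  rcases Finset.mem_insert.1 hb with rfl | hbB
  · rw [Function.update_self]
    refine ⟨hxu, fun b' hb' => ?_⟩
    rcases Finset.mem_insert.1 hb' with rfl | hbB'
    · simp [Γ.irrefl]
    · rw [Function.update_of_ne (hne _ hbB')]
      refine ⟨(hx b' hbB').1, fun hlt => ?_⟩
      by_contra h'
      exact absurd ((hx b' hbB').2.2.2 (not_le.1 h')) hlt.asymm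
  · rw [Function.update_of_ne (hne _ hbB)]
    refine ⟨(h b hbB).1, fun b' hb' => ?_⟩
    rcases Finset.mem_insert.1 hb' with rfl | hbB'
    · rw [Function.update_self]
      exact ⟨(hx b hbB).2.1, fun hlt => ((hx b hbB).2.2.1 hlt).le⟩
    · rw [Function.update_of_ne (hne _ hbB')]
      exact (h b hbB).2 b' hbB'

/-- Once every point of `D` has a preimage, each section over `D` of the collapse is a partial
automorphism by `IsCollapse.pair_eq`; this is how automorphisms are produced. -/
theorem IsCollapse.exists_extension {B : Finset A} {φ : A → A} (h : Γ.IsCollapse B φ)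
    (D : Finset A) : ∃ (B' : Finset A) (φ' : A → A), B ⊆ B' ∧ (∀ b ∈ B, φ' b = φ b) ∧
      Γ.IsCollapse B' φ' ∧ ∀ d ∈ D, ∃ b ∈ B', φ' b = d := by
  induction D using Finset.induction_on with
  | empty => exact ⟨B, φ, subset_rfl, fun _ _ => rfl, h, by simp⟩
  | insert d D _ ih =>
    obtain ⟨B', φ', h1, h2, h3, h4⟩ := ih
    obtain ⟨x, hx, h5⟩ := h3.exists_insert d
    have hne : ∀ b ∈ B', b ≠ x := fun b hb h => hx (h ▸ hb)
    refine ⟨_, _, h1.trans (Finset.subset_insert x B'), fun b hb => ?_, h5, fun d' hd' => ?_⟩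
    · rw [Function.update_of_ne (hne b (h1 hb)), h2 b hb]
    · rcases Finset.mem_insert.1 hd' with rfl | hd'
      · exact ⟨x, Finset.mem_insert_self x B', Function.update_self _ _ _⟩
      · obtain ⟨b, hb, rfl⟩ := h4 d' hd'
        exact ⟨b, Finset.mem_insert_of_mem hb, Function.update_of_ne (hne b hb) _ _⟩

variable (Γ) in
/-- The group `G` acts by automorphisms fixing `S` pointwise, and all finite partial automorphisms
fixing `S` extend to elements of `G`. -/
structure IsHomogeneousOver (S : Finset A) (G : Subgroup (Equiv.Perm A)) : Prop where
  fixes : ∀ g ∈ G, ∀ s ∈ S, g s = s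
  u_eq : ∀ g ∈ G, ∀ p, Γ.u (g p) = Γ.u p
  pair_eq : ∀ g ∈ G, ∀ p q, Γ.pair (g p) (g q) = Γ.pair p q
  extend : ∀ (D : Finset A) (γ : A → A), S ⊆ D → (∀ s ∈ S, γ s = s) → (∀ d ∈ D, Γ.u (γ d) = Γ.u d) →
    (∀ d ∈ D, ∀ d' ∈ D, d ≠ d' → Γ.pair (γ d) (γ d') = Γ.pair d d') → ∃ g ∈ G, ∀ d ∈ D, g d = γ d

variable {S : Finset A} {G : Subgroup (Equiv.Perm A)}

theorem IsHomogeneousOver.strictMono (hG : Γ.IsHomogeneousOver S G) (g : G) :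
    StrictMono (fun p : A => (g : Equiv.Perm A) p) := fun p q h =>
  (pair_eq_iff.1 (hG.pair_eq g g.2 p q)).2.2.1.2 h

theorem IsHomogeneousOver.sameType_smul (hG : Γ.IsHomogeneousOver S G) {ι : Type*} (o : ι → A)
    (g : G) : Γ.SameType S o (g • o) := by
  intro i
  refine ⟨hG.u_eq g g.2 _, fun s hs => ?_, fun j => hG.pair_eq g g.2 _ _⟩
  have := hG.pair_eq g g.2 (o i) s
  rwa [hG.fixes g g.2 s hs] at this

theorem IsHomogeneousOver.mem_orbit (hG : Γ.IsHomogeneousOver S G) {ι : Type*} [Finite ι]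
    {o a : ι → A} (h : Γ.SameType S o a) : a ∈ MulAction.orbit G o := by
  classical
  have := Fintype.ofFinite ι
  let γ : A → A := fun d => if h : ∃ i, o i = d then a h.choose else d
  have hγo : ∀ i, γ (o i) = a i := by
    intro i
    have h' : ∃ i', o i' = o i := ⟨i, rfl⟩
    simp only [γ, dif_pos h']
    exact h.apply_inj.2 h'.choose_spec
  have hγS : ∀ s ∈ S, γ s = s := by
    intro s hs
    by_cases h' : ∃ i, o i = s
    · obtain ⟨i, rfl⟩ := h'
      rw [hγo]
      exact (eq_iff_of_pair_eq ((h i).2.1 _ hs)).2 rfl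
    · simp only [γ, dif_neg h']
  obtain ⟨g, hg, hgD⟩ := hG.extend (S ∪ Finset.univ.image o) γ Finset.subset_union_left hγS (by
      intro d hd
      rcases Finset.mem_union.1 hd with hd | hd
      · rw [hγS d hd]
      · obtain ⟨i, -, rfl⟩ := Finset.mem_image.1 hd
        rw [hγo, (h i).1]) (by
      intro d hd d' hd' _
      rcases Finset.mem_union.1 hd with hd | hd <;> rcases Finset.mem_union.1 hd' with hd' | hd'
      · rw [hγS d hd, hγS d' hd']
      · obtain ⟨i, -, rfl⟩ := Finset.mem_image.1 hd'
        rw [hγS d hd, hγo]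
        exact pair_swap ((h i).2.1 d hd)
      · obtain ⟨i, -, rfl⟩ := Finset.mem_image.1 hd
        rw [hγS d' hd', hγo]
        exact (h i).2.1 d' hd'
      · obtain ⟨i, -, rfl⟩ := Finset.mem_image.1 hd
        obtain ⟨i', -, rfl⟩ := Finset.mem_image.1 hd'
        rw [hγo, hγo]
        exact (h i).2.2 i')
  refine ⟨⟨g, hg⟩, funext fun i => ?_⟩
  rw [← hγo i]
  exact hgD _ (Finset.mem_union_right _ (Finset.mem_image_of_mem o (Finset.mem_univ i)))

theorem IsHomogeneousOver.mem_orbit_iff (hG : Γ.IsHomogeneousOver S G) {ι : Type*} [Finite ι]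
    {o a : ι → A} : a ∈ MulAction.orbit G o ↔ Γ.SameType S o a := by
  refine ⟨?_, hG.mem_orbit⟩
  rintro ⟨g, rfl⟩
  exact hG.sameType_smul o g

/-- By homogeneity an orbit is determined by its atomic type over `S`, and there are finitely many
types. -/
theorem IsHomogeneousOver.finite_quotient (hG : Γ.IsHomogeneousOver S G) [Finite U] [Finite Q]
    (ι : Type*) [Finite ι] : Finite (MulAction.orbitRel.Quotient G (ι → A)) := by
  let τ : (ι → A) → (ι → U) × (ι → S → Q × Q × Prop × Prop) × (ι → ι → Q × Q × Prop × Prop) :=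
    fun a => (fun i => Γ.u (a i), fun i s => Γ.pair (a i) s, fun i j => Γ.pair (a i) (a j))
  refine Finite.of_injective (fun P : MulAction.orbitRel.Quotient G (ι → A) => τ P.out) ?_
  intro P P' h
  simp only [τ, Prod.mk.injEq] at h
  obtain ⟨h1, h2, h3⟩ := h
  have : P.out ∈ MulAction.orbit G P'.out := hG.mem_orbit fun i =>
    ⟨congrFun h1 i, fun s hs => congrFun (congrFun h2 i) ⟨s, hs⟩, fun j => congrFun (congrFun h3 i) j⟩
  rw [← Quotient.out_eq P, ← Quotient.out_eq P']
  exact Quotient.sound this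

/-- The twins of a cog are moved independently of each other by elements of `G` which move any
other point of a given finite set to a common image. -/
theorem IsHomogeneousOver.exists_twist (hG : Γ.IsHomogeneousOver S G) {ι : Type*} [Fintype ι]
    [DecidableEq ι] {o a₀ a₁ : ι → A} (ho : Function.Injective o) (hoS : ∀ i, o i ∉ S)
    (hnil : ∀ l, Γ.c (a₀ l) (a₁ l) = Γ.nil ∧ Γ.c (a₁ l) (a₀ l) = Γ.nil ∧ a₀ l ≠ a₁ l)
    (hpw : ∀ I : Finset ι, Γ.SameType S o (I.piecewise a₁ a₀)) (D : Finset A) :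
    ∃ g : Finset ι → G, (∀ I, g I • a₀ = I.piecewise a₁ a₀) ∧
      ∀ I l, ∀ d ∈ D, d ≠ a₀ l → (g (insert l I) : Equiv.Perm A) d = (g I : Equiv.Perm A) d := by
  classical
  let Tw : A → ι → Prop := fun p l => p = a₀ l ∨ p = a₁ l
  -- The proposition `ε` records which of the two twins `p` is, hence which corners have `p` at `l`.
  have hTwI : ∀ {p l}, Tw p l → ∃ ε : Prop, ∀ I : Finset ι, (l ∈ I ↔ ε) → I.piecewise a₁ a₀ l = p := by
    rintro p l (rfl | rfl)
    · exact ⟨False, fun I hI => Finset.piecewise_eq_of_notMem _ _ _ hI.1⟩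
    · exact ⟨True, fun I hI => Finset.piecewise_eq_of_mem _ _ _ (hI.2 trivial)⟩
  have hu : ∀ {p l}, Tw p l → Γ.u p = Γ.u (o l) ∧ ∀ s ∈ S, Γ.pair p s = Γ.pair (o l) s := by
    intro p l h
    obtain ⟨ε, hε⟩ := hTwI h
    have hI := hε (Finset.univ.filter fun i => i = l ∧ ε) (by simp)
    rw [← hI]
    exact ⟨(hpw _ l).1, (hpw _ l).2.1⟩
  have hpair : ∀ {p q l m}, Tw p l → Tw q m → l ≠ m → Γ.pair p q = Γ.pair (o l) (o m) := by
    intro p q l m hp hq hlm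
    obtain ⟨ε, hε⟩ := hTwI hp
    obtain ⟨δ, hδ⟩ := hTwI hq
    have h1 := hε (Finset.univ.filter fun i => (i = l ∧ ε) ∨ (i = m ∧ δ)) (by simp [hlm])
    have h2 := hδ (Finset.univ.filter fun i => (i = l ∧ ε) ∨ (i = m ∧ δ)) (by simp [hlm.symm])
    have h3 := (hpw (Finset.univ.filter fun i => (i = l ∧ ε) ∨ (i = m ∧ δ)) l).2.2 m
    rwa [h1, h2] at h3
  have hsame : ∀ {p q l}, Tw p l → Tw q l → Γ.c p q = Γ.nil := by
    rintro p q l (rfl | rfl) (rfl | rfl)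
    · exact Γ.irrefl _
    · exact (hnil l).1
    · exact (hnil l).2.1
    · exact Γ.irrefl _
  have hTwS : ∀ {p l}, Tw p l → p ∉ S := by
    intro p l h hp
    exact hoS l ((eq_iff_of_pair_eq ((hu h).2 p hp)).1 rfl ▸ hp)
  have huniq : ∀ {p l m}, Tw p l → Tw p m → l = m := by
    intro p l m hl hm
    by_contra hne
    exact hne (ho ((eq_iff_of_pair_eq (hpair hl hm hne)).1 rfl))
  let φ : A → A := fun p => if h : ∃ l, Tw p l then a₀ h.choose else p
  have hφT : ∀ {p l}, Tw p l → φ p = a₀ l := by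
    intro p l h
    have h' : ∃ l, Tw p l := ⟨l, h⟩
    simp only [φ, dif_pos h']
    rw [huniq h'.choose_spec h]
  have hφS : ∀ s ∈ S, φ s = s := by
    intro s hs
    have h' : ¬ ∃ l, Tw s l := fun ⟨l, h⟩ => hTwS h hs
    simp only [φ, dif_neg h']
  have hcol : Γ.IsCollapse (S ∪ (Finset.univ.image a₀ ∪ Finset.univ.image a₁)) φ := by
    have hcase : ∀ b ∈ S ∪ (Finset.univ.image a₀ ∪ Finset.univ.image a₁), b ∈ S ∨ ∃ l, Tw b l := by
      intro b hb
      simp only [Finset.mem_union, Finset.mem_image, Finset.mem_univ, true_and] at hb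
      rcases hb with hb | ⟨l, rfl⟩ | ⟨l, rfl⟩
      · exact Or.inl hb
      · exact Or.inr ⟨l, Or.inl rfl⟩
      · exact Or.inr ⟨l, Or.inr rfl⟩
    have hpc : ∀ {p q p' q' : A}, Γ.pair p q = Γ.pair p' q' →
        Γ.c p q = Γ.c p' q' ∧ (p < q → p' ≤ q') := fun h =>
      ⟨(pair_eq_iff.1 h).1, fun h' => ((pair_eq_iff.1 h).2.2.1.1 h').le⟩
    intro b hb
    rcases hcase b hb with hbS | ⟨l, hl⟩
    · rw [hφS b hbS]
      refine ⟨rfl, fun b' hb' => ?_⟩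
      rcases hcase b' hb' with hbS' | ⟨m, hm⟩
      · rw [hφS b' hbS']
        exact ⟨rfl, le_of_lt⟩
      · rw [hφT hm]
        exact hpc (pair_swap (((hu hm).2 b hbS).trans ((hu (Or.inl rfl)).2 b hbS).symm))
    · rw [hφT hl]
      refine ⟨(hu hl).1.trans (hu (Or.inl rfl)).1.symm, fun b' hb' => ?_⟩
      rcases hcase b' hb' with hbS' | ⟨m, hm⟩
      · rw [hφS b' hbS']
        exact hpc (((hu hl).2 b' hbS').trans ((hu (Or.inl rfl)).2 b' hbS').symm)
      · rw [hφT hm]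
        by_cases hlm : l = m
        · subst hlm
          rw [hsame hl hm, Γ.irrefl]
          exact ⟨rfl, fun _ => le_rfl⟩
        · exact hpc ((hpair hl hm hlm).trans (hpair (Or.inl rfl) (Or.inl rfl) hlm).symm)
  obtain ⟨B', φ', hBB, hφ', hcol', hD⟩ := hcol.exists_extension (D ∪ S ∪ Finset.univ.image a₀)
  have hB₀ : ∀ l, a₀ l ∈ S ∪ (Finset.univ.image a₀ ∪ Finset.univ.image a₁) := fun l => by simp
  have hB₁ : ∀ l, a₁ l ∈ S ∪ (Finset.univ.image a₀ ∪ Finset.univ.image a₁) := fun l => by simp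
  have hBS : ∀ s ∈ S, s ∈ S ∪ (Finset.univ.image a₀ ∪ Finset.univ.image a₁) := fun s hs => by simp [hs]
  have ha₀ : Function.Injective a₀ := fun l m h => huniq (Or.inl rfl) (Or.inl h)
  choose! δ hδB hδ using hD
  -- A section of the collapse: `a₀ l` is lifted to the twin chosen by `I`, every other point to a
  -- preimage that does not depend on `I`.
  let γ : Finset ι → A → A := fun I d =>
    if h : ∃ l, a₀ l = d then I.piecewise a₁ a₀ h.choose else if d ∈ S then d else δ d
  have hγ₀ : ∀ I l, γ I (a₀ l) = I.piecewise a₁ a₀ l := by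
    intro I l
    have h : ∃ l', a₀ l' = a₀ l := ⟨l, rfl⟩
    simp only [γ, dif_pos h]
    rw [ha₀ h.choose_spec]
  have hγS : ∀ I, ∀ s ∈ S, γ I s = s := by
    intro I s hs
    have h : ¬ ∃ l, a₀ l = s := fun ⟨l, h⟩ => hTwS (Or.inl rfl : Tw (a₀ l) l) (h ▸ hs)
    simp only [γ, dif_neg h, if_pos hs]
  have hγ : ∀ I, ∀ d ∈ D ∪ S ∪ Finset.univ.image a₀, γ I d ∈ B' ∧ φ' (γ I d) = d := by
    intro I d hd
    by_cases h : ∃ l, a₀ l = d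
    · obtain ⟨l, rfl⟩ := h
      rw [hγ₀]
      by_cases hl : l ∈ I
      · rw [Finset.piecewise_eq_of_mem _ _ _ hl]
        exact ⟨hBB (hB₁ l), by rw [hφ' _ (hB₁ l), hφT (Or.inr rfl)]⟩
      · rw [Finset.piecewise_eq_of_notMem _ _ _ hl]
        exact ⟨hBB (hB₀ l), by rw [hφ' _ (hB₀ l), hφT (Or.inl rfl)]⟩
    · by_cases hs : d ∈ S
      · rw [hγS I d hs]
        exact ⟨hBB (hBS d hs), by rw [hφ' _ (hBS d hs), hφS d hs]⟩
      · simp only [γ, dif_neg h, if_neg hs]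
        exact ⟨hδB d hd, hδ d hd⟩
  have hex : ∀ I, ∃ g : G, ∀ d ∈ D ∪ S ∪ Finset.univ.image a₀, (g : Equiv.Perm A) d = γ I d := by
    intro I
    obtain ⟨g, hg, hgD⟩ := hG.extend (D ∪ S ∪ Finset.univ.image a₀) (γ I)
      (fun s hs => by simp [hs]) (hγS I)
      (fun d hd => by
        have := (hcol' _ (hγ I d hd).1).1
        rwa [(hγ I d hd).2] at this)
      (fun d hd d' hd' hne => by
        have := hcol'.pair_eq (hγ I d hd).1 (hγ I d' hd').1
        rw [(hγ I d hd).2, (hγ I d' hd').2] at this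
        exact this hne)
    exact ⟨⟨g, hg⟩, hgD⟩
  choose g hg using hex
  refine ⟨g, fun I => funext fun l => ?_, fun I l d hd hdl => ?_⟩
  · rw [← hγ₀]
    exact hg I _ (by simp)
  · rw [hg _ d (by simp [hd]), hg _ d (by simp [hd])]
    by_cases h : ∃ m, a₀ m = d
    · obtain ⟨m, rfl⟩ := h
      rw [hγ₀, hγ₀]
      have hml : m ≠ l := fun h => hdl (h ▸ rfl)
      by_cases hm : m ∈ I
      · rw [Finset.piecewise_eq_of_mem _ _ _ hm,
          Finset.piecewise_eq_of_mem _ _ _ (Finset.mem_insert_of_mem hm)]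
      · rw [Finset.piecewise_eq_of_notMem _ _ _ hm,
          Finset.piecewise_eq_of_notMem _ _ _ (by simp [hm, hml])]
    · simp only [γ, dif_neg h]

end GenericColoring

/-! ### Projections to fewer coordinates, and lifting cogs to equivariant subspaces. -/

namespace GenericColoring

section Coordinates

variable {A : Type*} {G : Subgroup (Equiv.Perm A)} {F : Type*} [Field F] {d k : ℕ}

open Classical in
/-- Keep only the tuples from the orbit `P` and forget all but the entries selected by `s`. -/
noncomputable def coord (P : MulAction.orbitRel.Quotient G (Fin d → A)) (s : Fin k → Fin d) :
    ((Fin d → A) →₀ F) →ₗ[F] ((Fin k → A) →₀ F) :=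
  Finsupp.lmapDomain F F (fun x => x ∘ s) ∘ₗ
    { toFun := fun v => v.filter
        (fun x => (Quotient.mk _ x : MulAction.orbitRel.Quotient G (Fin d → A)) = P)
      map_add' := fun _ _ => Finsupp.filter_add
      map_smul' := fun _ _ => Finsupp.filter_smul }

open Classical in
theorem coord_eq (P : MulAction.orbitRel.Quotient G (Fin d → A)) (s : Fin k → Fin d)
    (v : (Fin d → A) →₀ F) : coord P s v = (v.filter
        (fun x => (Quotient.mk _ x : MulAction.orbitRel.Quotient G (Fin d → A)) = P)).mapDomain
          (fun x => x ∘ s) := rfl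

theorem exists_of_coord_ne_zero {P : MulAction.orbitRel.Quotient G (Fin d → A)} {s : Fin k → Fin d}
    {v : (Fin d → A) →₀ F} {a : Fin k → A} (h : coord P s v a ≠ 0) :
    ∃ x ∈ v.support, (Quotient.mk _ x : MulAction.orbitRel.Quotient G (Fin d → A)) = P ∧
      x ∘ s = a := by
  classical
  rw [coord_eq, ← Finsupp.mem_support_iff] at h
  obtain ⟨x, hx, rfl⟩ := Finset.mem_image.1 (Finsupp.mapDomain_support h)
  rw [Finsupp.support_filter, Finset.mem_filter] at hx
  exact ⟨x, hx.1, hx.2, rfl⟩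

theorem linAct_apply_smul {E X : Type*} [AddCommGroup E] [Module F E] [MulAction G X] (g : G)
    (v : X →₀ E) (a : X) : linAct F E g v (g • a) = v a :=
  Finsupp.mapDomain_apply (MulAction.injective g) v a

theorem linAct_apply {E X : Type*} [AddCommGroup E] [Module F E] [MulAction G X] (g : G)
    (v : X →₀ E) (a : X) : linAct F E g v a = v (g⁻¹ • a) := by
  rw [← linAct_apply_smul (F := F) g v, smul_inv_smul]

theorem coord_linAct (P : MulAction.orbitRel.Quotient G (Fin d → A)) (s : Fin k → Fin d)
    (g : G) (v : (Fin d → A) →₀ F) : coord P s (linAct F F g v) = linAct F F g (coord P s v) := by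
  classical
  simp only [coord_eq, linAct, Finsupp.lmapDomain_apply]
  rw [Finsupp.filter_mapDomain_eq (q := fun x =>
      (Quotient.mk _ x : MulAction.orbitRel.Quotient G (Fin d → A)) = P),
    ← Finsupp.mapDomain_comp, ← Finsupp.mapDomain_comp]
  · rfl
  · intro x
    rw [show (Quotient.mk _ (g • x) : MulAction.orbitRel.Quotient G (Fin d → A)) = Quotient.mk _ x
      from Quotient.sound ⟨g, rfl⟩]

theorem mapDomain_update_coord (P : MulAction.orbitRel.Quotient G (Fin d → A))
    (s : Fin (k + 1) → Fin d) (j : Fin (k + 1)) (p : A) (v : (Fin d → A) →₀ F) :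
    (coord P s v).mapDomain (fun a => Function.update a j p) =
      (coord P (s ∘ j.succAbove) v).mapDomain (fun b => j.insertNth (α := fun _ => A) p b) := by
  classical
  rw [coord_eq, coord_eq, ← Finsupp.mapDomain_comp, ← Finsupp.mapDomain_comp]
  congr 1
  ext x : 1
  exact (Fin.insertNth_removeNth (α := fun _ => A) j p (x ∘ s)).symm

variable [Finite (MulAction.orbitRel.Quotient G (Fin d → A))]

variable (G F d k) in
open Classical in
/-- All maps `coord P s` together. -/
noncomputable def coords : ((Fin d → A) →₀ F) →ₗ[F]
    ((Fin k → A) →₀ (MulAction.orbitRel.Quotient G (Fin d → A) × (Fin k → Fin d) → F)) :=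
  letI := Fintype.ofFinite (MulAction.orbitRel.Quotient G (Fin d → A))
  ∑ q : MulAction.orbitRel.Quotient G (Fin d → A) × (Fin k → Fin d),
    Finsupp.mapRange.linearMap (LinearMap.single F (fun _ => F) q) ∘ₗ coord q.1 q.2

theorem coords_apply (v : (Fin d → A) →₀ F) (a : Fin k → A)
    (q : MulAction.orbitRel.Quotient G (Fin d → A) × (Fin k → Fin d)) :
    coords G F d k v a q = coord q.1 q.2 v a := by
  classical
  simp only [coords, LinearMap.sum_apply, Finsupp.finsetSum_apply, Finset.sum_apply]
  rw [Finset.sum_eq_single q]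
  · simp
  · intro q' _ hq
    simp [hq.symm]
  · simp

theorem coords_linAct (g : G) (v : (Fin d → A) →₀ F) :
    coords G F d k (linAct F F g v) = linAct F _ g (coords G F d k v) := by
  ext a q
  rw [coords_apply, coord_linAct, linAct_apply, linAct_apply, coords_apply]

end Coordinates

theorem cog_map {A ι E E' : Type*} [DecidableEq ι] [AddCommGroup E] [AddCommGroup E'] (f : E →+ E')
    (J : Finset ι) (a₀ a₁ : ι → A) (e : E) (b : ι → A) :
    f (cog J a₀ a₁ e b) = cog J a₀ a₁ (f e) b := by
  classical
  simp only [cog, Finsupp.finsetSum_apply, map_sum, Finsupp.smul_apply, map_zsmul,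
    Finsupp.single_apply]
  refine Finset.sum_congr rfl fun I _ => ?_
  split_ifs <;> simp

variable {A U Q : Type*} [LinearOrder A] {Γ : GenericColoring A U Q} {S : Finset A}
  {G : Subgroup (Equiv.Perm A)}

theorem le_of_strictMono_of_forall_exists {k k' : ℕ} {a : Fin k' → A} {a₀ : Fin k → A}
    (ha₀ : StrictMono a₀) (h : ∀ l, ∃ i, a i = a₀ l) : k ≤ k' := by
  choose f hf using h
  have : Function.Injective f := fun l m hlm => ha₀.injective (by rw [← hf, ← hf, hlm])
  simpa using Fintype.card_le_of_injective f this

theorem eq_of_strictMono_of_forall_exists {k : ℕ} {a a₀ : Fin k → A}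
    (ha : StrictMono a) (ha₀ : StrictMono a₀) (h : ∀ l, ∃ i, a i = a₀ l) : a = a₀ := by
  choose f hf using h
  have hinj : Function.Injective f := fun l m hlm => ha₀.injective (by rw [← hf, ← hf, hlm])
  have hsurj := Finite.surjective_of_injective hinj
  refine (ha.range_inj ha₀).1 (Set.Subset.antisymm ?_ ?_)
  · rintro _ ⟨i, rfl⟩
    obtain ⟨l, rfl⟩ := hsurj i
    exact ⟨l, (hf l).symm⟩
  · rintro _ ⟨l, rfl⟩
    exact ⟨f l, hf l⟩

theorem SameType.strictMono {k : ℕ} {o a : Fin k → A} (h : Γ.SameType S o a)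
    (ho : StrictMono o) : StrictMono a := fun i j hij =>
  (pair_eq_iff.1 ((h i).2.2 j)).2.2.1.2 (ho hij)

theorem IsHomogeneousOver.strictMono_smul_iff (hG : Γ.IsHomogeneousOver S G) {k : ℕ} (g : G)
    (a : Fin k → A) : StrictMono (g • a) ↔ StrictMono a := by
  refine ⟨fun h => ?_, fun h => (hG.strictMono g).comp h⟩
  have := (hG.strictMono g⁻¹).comp h
  convert this using 1
  exact (inv_smul_smul g a).symm

section Twist

variable {F : Type*} [Field F] {k : ℕ} {a₀ a₁ : Fin k → A} {g : Finset (Fin k) → G} {D : Finset A}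

-- The terms for `I` and `insert l I` have the same tuple and opposite signs.
omit [LinearOrder A] in
theorem twist_single_eq_zero {k' : ℕ}
    (hg : ∀ I l, ∀ d ∈ D, d ≠ a₀ l → (g (insert l I) : Equiv.Perm A) d = (g I : Equiv.Perm A) d)
    (a : Fin k' → A) (haD : ∀ i, a i ∈ D) (l : Fin k) (hl : ∀ i, a i ≠ a₀ l) (e : F) :
    ∑ I : Finset (Fin k), (-1 : ℤ) ^ I.card • Finsupp.single (g I • a) e = 0 := by
  rw [← Finset.powerset_univ, ← Finset.insert_erase (Finset.mem_univ l),
    Finset.sum_powerset_insert (Finset.notMem_erase l _), ← Finset.sum_add_distrib]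
  refine Finset.sum_eq_zero fun I hI => ?_
  have hlI : l ∉ I := fun h => Finset.notMem_erase l _ (Finset.mem_powerset.1 hI h)
  have : g (insert l I) • a = g I • a := funext fun i => hg I l (a i) (haD i) (hl i)
  rw [this, Finset.card_insert_of_notMem hlI, pow_succ]
  simp

/-- A tuple missing some `a₀ l` cancels by `twist_single_eq_zero`; one that is not increasing never
reaches `b`, because automorphisms preserve the order. -/
theorem IsHomogeneousOver.twist_apply (hG : Γ.IsHomogeneousOver S G)
    (hg : ∀ I l, ∀ d ∈ D, d ≠ a₀ l → (g (insert l I) : Equiv.Perm A) d = (g I : Equiv.Perm A) d)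
    {k' : ℕ} (y : (Fin k' → A) →₀ F) (hy : ∀ a ∈ y.support, ∀ i, a i ∈ D) (b : Fin k' → A)
    (hb : StrictMono b) :
    (∑ I : Finset (Fin k), (-1 : ℤ) ^ I.card • linAct F F (g I) y) b =
      ∑ a ∈ y.support with StrictMono a ∧ ∀ l, ∃ i, a i = a₀ l,
        (∑ I : Finset (Fin k), (-1 : ℤ) ^ I.card • Finsupp.single (g I • a) (y a)) b := by
  classical
  have h1 : ∑ I : Finset (Fin k), (-1 : ℤ) ^ I.card • linAct F F (g I) y =
      ∑ a ∈ y.support, ∑ I : Finset (Fin k), (-1 : ℤ) ^ I.card • Finsupp.single (g I • a) (y a) := by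
    rw [Finset.sum_comm]
    refine Finset.sum_congr rfl fun I _ => ?_
    rw [← Finset.smul_sum]
    rfl
  rw [h1, Finsupp.finsetSum_apply, Finset.sum_filter]
  refine Finset.sum_congr rfl fun a ha => ?_
  split_ifs with h
  · rfl
  by_cases hmono : StrictMono a
  · have : ∃ l, ∀ i, a i ≠ a₀ l := by
      by_contra! h'
      exact h ⟨hmono, h'⟩
    obtain ⟨l, hl⟩ := this
    rw [twist_single_eq_zero hg a (hy a ha) l hl, Finsupp.zero_apply]
  · rw [Finsupp.finsetSum_apply]
    refine Finset.sum_eq_zero fun I _ => ?_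
    rw [Finsupp.smul_apply, Finsupp.single_apply, if_neg, smul_zero]
    rintro rfl
    exact hmono ((hG.strictMono_smul_iff _ _).1 hb)

variable {d : ℕ}

/-- Every cog is obtained from a vector of an equivariant subspace which has the coefficients of the
cog at one of its tuples. -/
theorem IsHomogeneousOver.exists_coord_eq_cog (hG : Γ.IsHomogeneousOver S G)
    {W : Submodule F ((Fin d → A) →₀ F)} (hW : IsEquivariantSubspace G W)
    {w : (Fin d → A) →₀ F} (hw : w ∈ W) {o : Fin k → A} (ho : StrictMono o) (hoS : ∀ i, o i ∉ S)
    (hnil : ∀ l, Γ.c (a₀ l) (a₁ l) = Γ.nil ∧ Γ.c (a₁ l) (a₀ l) = Γ.nil ∧ a₀ l ≠ a₁ l)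
    (hpw : ∀ I : Finset (Fin k), Γ.SameType S o (I.piecewise a₁ a₀)) :
    ∃ w' ∈ W, (∀ k' < k, ∀ P (s : Fin k' → Fin d) b, StrictMono b → coord (G := G) P s w' b = 0) ∧
      ∀ P (s : Fin k → Fin d) b, StrictMono b →
        coord (G := G) P s w' b = cog Finset.univ a₀ a₁ (coord (G := G) P s w a₀) b := by
  classical
  let D : Finset A := w.support.biUnion fun x => Finset.univ.image x
  obtain ⟨g, hg₀, hg⟩ := hG.exists_twist ho.injective hoS hnil hpw D
  have ha₀ : StrictMono a₀ := by
    have := (hpw ∅).strictMono ho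
    rwa [Finset.piecewise_empty] at this
  have hD : ∀ {k' : ℕ} P (s : Fin k' → Fin d), ∀ a ∈ (coord (G := G) P s w).support, ∀ i, a i ∈ D := by
    intro k' P s a ha i
    obtain ⟨x, hx, -, rfl⟩ := exists_of_coord_ne_zero (Finsupp.mem_support_iff.1 ha)
    exact Finset.mem_biUnion.2 ⟨x, hx, Finset.mem_image_of_mem x (Finset.mem_univ _)⟩
  have hcoord : ∀ {k' : ℕ} P (s : Fin k' → Fin d), coord (G := G) P s
      (∑ I : Finset (Fin k), (-1 : ℤ) ^ I.card • linAct F F (g I) w) =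
      ∑ I : Finset (Fin k), (-1 : ℤ) ^ I.card • linAct F F (g I) (coord (G := G) P s w) := by
    intro k' P s
    rw [map_sum]
    refine Finset.sum_congr rfl fun I _ => ?_
    rw [map_zsmul, coord_linAct]
  refine ⟨∑ I : Finset (Fin k), (-1 : ℤ) ^ I.card • linAct F F (g I) w,
    Submodule.sum_mem _ fun I _ => zsmul_mem (hW _ _ hw) _, ?_, ?_⟩
  -- A surviving tuple contains the `k` distinct entries of `a₀`: impossible for length less than
  -- `k`, and for length `k` it must be `a₀` itself.
  · intro k' hk P s b hb
    rw [hcoord, hG.twist_apply hg _ (hD P s) b hb, Finset.sum_eq_zero]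
    intro a ha
    have := (Finset.mem_filter.1 ha).2
    exact absurd (le_of_strictMono_of_forall_exists ha₀ this.2) (not_le.2 hk)
  · intro P s b hb
    rw [hcoord, hG.twist_apply hg _ (hD P s) b hb, Finset.sum_eq_single a₀]
    · simp only [hg₀]
      rw [cog, Finset.powerset_univ]
    · intro a ha hne
      have := (Finset.mem_filter.1 ha).2
      exact absurd (eq_of_strictMono_of_forall_exists this.1 ha₀ this.2) hne
    · intro h
      have : coord (G := G) P s w a₀ = 0 := by
        by_contra h'
        exact h (Finset.mem_filter.2 ⟨Finsupp.mem_support_iff.2 h', ha₀, fun l => ⟨l, rfl⟩⟩)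
      simp [this]

end Twist

end GenericColoring

/-! ### Reconstruction of an equivariant subspace from its restrictions. -/

namespace GenericColoring

variable {A U Q : Type*} [LinearOrder A] {Γ : GenericColoring A U Q} {S : Finset A}
  {G : Subgroup (Equiv.Perm A)} {F : Type*} [Field F] {d : ℕ}

theorem isOrdered_iff_of_mem_orbit (hG : Γ.IsHomogeneousOver S G) {k : ℕ} {o a : Fin k → A}
    (h : a ∈ MulAction.orbit G o) :
    ((∀ i, a i ∉ S) ∧ StrictMono a) ↔ ((∀ i, o i ∉ S) ∧ StrictMono o) := by
  have key : ∀ {o a : Fin k → A}, a ∈ MulAction.orbit G o →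
      ((∀ i, o i ∉ S) ∧ StrictMono o) → ((∀ i, a i ∉ S) ∧ StrictMono a) := by
    intro o a h ho
    have := hG.mem_orbit_iff.1 h
    exact ⟨fun i => this.notMem (ho.1 i), this.strictMono ho.2⟩
  exact ⟨key (MulAction.mem_orbit_symm.1 h), key h⟩

/-- A vector without coefficients at ordered tuples is zero. -/
theorem IsHomogeneousOver.eq_zero_of_coord (hG : Γ.IsHomogeneousOver S G) (u : (Fin d → A) →₀ F)
    (hu : ∀ k ≤ d, ∀ P (s : Fin k → Fin d) (a : Fin k → A), (∀ i, a i ∉ S) → StrictMono a →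
      coord (G := G) P s u a = 0) : u = 0 := by
  classical
  ext x
  -- Let `s` pick one position for each entry of `x` outside `S`, in increasing order. On the orbit
  -- of `x` projection along `s` is injective, as the other entries are constants or repetitions; so
  -- the coefficient at `x` is an ordered coordinate.
  let T : Finset A := Finset.univ.image x \ S
  have hT : T.card ≤ d := (Finset.card_le_card Finset.sdiff_subset).trans
    (Finset.card_image_le.trans (by simp))
  have hmem : ∀ i, ∃ l, x l = T.orderEmbOfFin rfl i := by
    intro i
    have := T.orderEmbOfFin_mem rfl i
    obtain ⟨l, -, hl⟩ := Finset.mem_image.1 (Finset.mem_sdiff.1 this).1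
    exact ⟨l, hl⟩
  choose s hs using hmem
  have hxs : x ∘ s = T.orderEmbOfFin rfl := funext hs
  have h := hu T.card hT (Quotient.mk _ x) s (x ∘ s)
    (fun i => by
      rw [hxs]
      exact (Finset.mem_sdiff.1 (T.orderEmbOfFin_mem rfl i)).2)
    (by rw [hxs]; exact (T.orderEmbOfFin rfl).strictMono)
  rw [coord_eq, Finsupp.mapDomain_apply'
    {y | (Quotient.mk _ y : MulAction.orbitRel.Quotient G (Fin d → A)) = Quotient.mk _ x}] at h
  · simpa using h
  · intro y hy
    simp only [Finsupp.support_filter, Finset.coe_filter, Set.mem_ofPred_eq] at hy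
    exact hy.2
  rotate_left
  · rfl
  · have key : ∀ y ∈ {y | (Quotient.mk _ y : MulAction.orbitRel.Quotient G (Fin d → A)) =
        Quotient.mk _ x}, ∃ g : G, g • x = y ∧ ∀ p, (p ∈ S ∨ ∃ l, x l = p) →
          (p ∈ S ∨ ∃ i, x (s i) = p) := by
      intro y hy
      obtain ⟨g, hg⟩ := Quotient.exact hy
      refine ⟨g, hg, ?_⟩
      rintro p (hp | ⟨l, rfl⟩)
      · exact Or.inl hp
      · by_cases hp : x l ∈ S
        · exact Or.inl hp
        · have : x l ∈ T := Finset.mem_sdiff.2 ⟨Finset.mem_image_of_mem x (Finset.mem_univ l), hp⟩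
          rw [← Finset.mem_coe, ← Finset.range_orderEmbOfFin T rfl] at this
          obtain ⟨i, hi⟩ := this
          exact Or.inr ⟨i, (hs i).trans hi⟩
    intro y hy z hz hyz
    obtain ⟨g, rfl, hS⟩ := key y hy
    obtain ⟨g', rfl, -⟩ := key z hz
    funext l
    rcases hS (x l) (Or.inr ⟨l, rfl⟩) with h' | ⟨i, hi⟩
    · exact (hG.fixes g g.2 _ h').trans (hG.fixes g' g'.2 _ h').symm
    · have := congrFun hyz i
      change (g : Equiv.Perm A) (x l) = (g' : Equiv.Perm A) (x l)
      rw [← hi]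
      exact this

variable [Finite (MulAction.orbitRel.Quotient G (Fin d → A))]

/-- If the ordered projections of `u` to fewer coordinates vanish, its coefficients at an ordered
orbit form a cycle. -/
theorem IsHomogeneousOver.isCycle_of_coord (hG : Γ.IsHomogeneousOver S G) {k : ℕ} {o : Fin k → A}
    (ho : StrictMono o) (hoS : ∀ i, o i ∉ S) {u : (Fin d → A) →₀ F}
    (hu : ∀ l < k, ∀ P (s : Fin l → Fin d) (a : Fin l → A), (∀ i, a i ∉ S) → StrictMono a →
      coord (G := G) P s u a = 0)
    (E : Submodule F (MulAction.orbitRel.Quotient G (Fin d → A) × (Fin k → Fin d) → F))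
    (y : (Fin k → A) →₀ E) (hy : ∀ a ∈ MulAction.orbit G o, (y a).1 = coords G F d k u a)
    (hy' : ∀ a ∉ MulAction.orbit G o, y a = 0) : Γ.IsCycle S o Finset.univ y := by
  classical
  refine ⟨fun a ha => ?_, by simp, fun j _ p => ?_⟩
  · by_contra h
    exact Finsupp.mem_support_iff.1 ha (hy' a fun h' => h (hG.mem_orbit_iff.1 h'))
  obtain ⟨l, rfl⟩ : ∃ l, k = l + 1 := ⟨k - 1, by have := j.2; omega⟩
  -- Componentwise, either `s` projects all of `P` into the orbit of `o`, and forgetting `j` factors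
  -- through a shorter ordered projection, zero by `hu`; or no tuple of `P` lands there and the
  -- component is zero.
  have key : ∀ q, (y.mapRange (fun e : E => e.1 q) rfl).mapDomain
      (fun a => Function.update a j p) = 0 := by
    rintro ⟨P, s⟩
    have hval : ∀ a ∈ MulAction.orbit G o, (y a).1 (P, s) = coord P s u a := fun a ha => by
      rw [hy a ha, coords_apply]
    by_cases hPs : ∃ x, (Quotient.mk _ x : MulAction.orbitRel.Quotient G (Fin d → A)) = P ∧
        x ∘ s ∈ MulAction.orbit G o
    · obtain ⟨x, hxP, hx⟩ := hPs
      have hall : ∀ z, (Quotient.mk _ z : MulAction.orbitRel.Quotient G (Fin d → A)) = P →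
          z ∘ s ∈ MulAction.orbit G o := by
        intro z hz
        obtain ⟨g, rfl⟩ := Quotient.exact (hz.trans hxP.symm)
        obtain ⟨g', hg'⟩ := hx
        refine ⟨g * g', ?_⟩
        simp only [mul_smul] at hg' ⊢
        rw [hg']
        rfl
      have heq : y.mapRange (fun e : E => e.1 (P, s)) rfl = coord P s u := by
        ext a
        rw [Finsupp.mapRange_apply]
        by_cases ha : a ∈ MulAction.orbit G o
        · exact hval a ha
        · rw [hy' a ha]
          by_contra h
          obtain ⟨z, -, hz, rfl⟩ := exists_of_coord_ne_zero (fun h' => h h'.symm)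
          exact ha (hall z hz)
      have hzero : coord P (s ∘ j.succAbove) u = 0 := by
        ext b
        by_contra h
        obtain ⟨z, -, hz, rfl⟩ := exists_of_coord_ne_zero h
        have hzs := (isOrdered_iff_of_mem_orbit hG (hall z hz)).2 ⟨hoS, ho⟩
        exact h (hu l (Nat.lt_succ_self l) _ _ _ (fun i => hzs.1 (j.succAbove i))
          (hzs.2.comp j.strictMono_succAbove))
      rw [heq, mapDomain_update_coord, hzero, Finsupp.mapDomain_zero]
    · have heq : y.mapRange (fun e : E => e.1 (P, s)) rfl = 0 := by
        ext a
        rw [Finsupp.mapRange_apply]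
        by_cases ha : a ∈ MulAction.orbit G o
        · rw [hval a ha]
          by_contra h
          obtain ⟨z, -, hz, rfl⟩ := exists_of_coord_ne_zero h
          exact hPs ⟨z, hz, ha⟩
        · rw [hy' a ha]
          rfl
      rw [heq, Finsupp.mapDomain_zero]
  ext b q
  have h := DFunLike.congr_fun (key q) b
  have hcomm := Finsupp.mapDomain_mapRange (fun a : Fin (l + 1) → A => Function.update a j p) y
    (fun e : E => e.1 q) rfl (fun _ _ => rfl)
  rw [hcomm, Finsupp.mapRange_apply] at h
  exact h

/-- The coefficients of `u` at the orbit form a cycle with values in the space `E` of values of `W`.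
It is decomposed into cogs over `E` itself, so that the coefficient of each cog is a value of some
element of `W` and the cog can be lifted. -/
theorem IsHomogeneousOver.exists_coord_eq_on_orbit (hG : Γ.IsHomogeneousOver S G)
    {W : Submodule F ((Fin d → A) →₀ F)} (hW : IsEquivariantSubspace G W) {k : ℕ} {o : Fin k → A}
    (ho : StrictMono o) (hoS : ∀ i, o i ∉ S) {u : (Fin d → A) →₀ F}
    (hu : ∀ l < k, ∀ P (s : Fin l → Fin d) (a : Fin l → A), (∀ i, a i ∉ S) → StrictMono a →
      coord (G := G) P s u a = 0)
    (huW : ∀ a : Fin k → A, (∀ i, a i ∉ S) → StrictMono a →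
      ∃ w ∈ W, ∀ P (s : Fin k → Fin d), coord (G := G) P s w a = coord P s u a) :
    ∃ w ∈ W, (∀ l < k, ∀ P (s : Fin l → Fin d) (a : Fin l → A), (∀ i, a i ∉ S) → StrictMono a →
      coord (G := G) P s w a = 0) ∧
      ∀ P (s : Fin k → Fin d) (a : Fin k → A), StrictMono a →
        (a ∈ MulAction.orbit G o → coord (G := G) P s w a = coord P s u a) ∧
        (a ∉ MulAction.orbit G o → coord (G := G) P s w a = 0) := by
  classical
  let E : Submodule F (MulAction.orbitRel.Quotient G (Fin d → A) × (Fin k → Fin d) → F) :=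
    W.map (Finsupp.lapply o ∘ₗ coords G F d k)
  have hE : ∀ e ∈ E, ∀ a ∈ MulAction.orbit G o, ∃ w ∈ W, coords G F d k w a = e := by
    rintro _ ⟨w, hw, rfl⟩ _ ⟨g, rfl⟩
    exact ⟨linAct F F g w, hW g w hw, by
      simp only [coords_linAct, linAct_apply_smul]
      rfl⟩
  have hEu : ∀ a, coords G F d k u a ∈ E ∨ a ∉ MulAction.orbit G o := by
    intro a
    by_cases ha : a ∈ MulAction.orbit G o
    · left
      obtain ⟨h1, h2⟩ := (isOrdered_iff_of_mem_orbit hG ha).2 ⟨hoS, ho⟩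
      obtain ⟨w, hw, h⟩ := huW a h1 h2
      obtain ⟨g, rfl⟩ := ha
      refine ⟨linAct F F g⁻¹ w, hW _ w hw, ?_⟩
      simp only [LinearMap.comp_apply, coords_linAct, Finsupp.lapply_apply]
      ext q
      rw [linAct_apply, inv_inv, coords_apply, coords_apply]
      exact h q.1 q.2
    · exact Or.inr ha
  let y : (Fin k → A) →₀ E := Finsupp.onFinset (coords G F d k u).support
    (fun a => if h : a ∈ MulAction.orbit G o then
      ⟨coords G F d k u a, (hEu a).resolve_right (not_not.2 h)⟩ else 0) (by
        intro a ha
        rw [Finsupp.mem_support_iff]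
        intro h0
        apply ha
        split_ifs with h
        · exact Subtype.ext h0
        · rfl)
  have hy : ∀ a ∈ MulAction.orbit G o, (y a).1 = coords G F d k u a := by
    intro a ha
    simp [y, ha]
  have hy' : ∀ a ∉ MulAction.orbit G o, y a = 0 := by
    intro a ha
    simp [y, ha]
  have hcyc := hG.isCycle_of_coord ho hoS hu E y hy hy'
  -- The vectors that lift to `W` without lower coordinates form a subgroup, so it suffices to lift
  -- cogs.
  let V : AddSubgroup ((Fin k → A) →₀ E) :=
    { carrier := {z | ∃ w ∈ W, (∀ l < k, ∀ P (s : Fin l → Fin d) (a : Fin l → A), StrictMono a →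
        coord (G := G) P s w a = 0) ∧ ∀ P (s : Fin k → Fin d) (a : Fin k → A), StrictMono a →
          coord (G := G) P s w a = (z a).1 (P, s)}
      zero_mem' := ⟨0, zero_mem _, by simp, by simp⟩
      add_mem' := by
        rintro z z' ⟨w, hw, h1, h2⟩ ⟨w', hw', h1', h2'⟩
        refine ⟨w + w', add_mem hw hw', fun l hl P s a ha => ?_, fun P s a ha => ?_⟩
        · simp [h1 l hl P s a ha, h1' l hl P s a ha]
        · simp [h2 P s a ha, h2' P s a ha]
      neg_mem' := by
        rintro z ⟨w, hw, h1, h2⟩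
        refine ⟨-w, neg_mem hw, fun l hl P s a ha => ?_, fun P s a ha => ?_⟩
        · simp [h1 l hl P s a ha]
        · simp [h2 P s a ha] }
  have hyV : y ∈ V := by
    have hmem := hcyc.mem_closure_cogs Finset.univ S o y (fun j _ => hoS j) (by simp) ho.injective
    refine (AddSubgroup.closure_le V).2 ?_ hmem
    rintro _ ⟨a₀, a₁, e, -, hnil, hpw, rfl⟩
    have ha₀ : a₀ ∈ MulAction.orbit G o := by
      have := hpw ∅ (Finset.empty_subset _)
      rw [Finset.piecewise_empty] at this
      exact hG.mem_orbit this
    obtain ⟨w, hw, hwe⟩ := hE e.1 e.2 a₀ ha₀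
    obtain ⟨w', hw', h1, h2⟩ := hG.exists_coord_eq_cog hW hw ho hoS
      (fun l => hnil l (Finset.mem_univ l)) (fun I => hpw I (Finset.subset_univ I))
    refine ⟨w', hw', h1, fun P s a ha => ?_⟩
    rw [h2 P s a ha]
    have := cog_map ((Pi.evalAddMonoidHom _ (P, s)).comp E.subtype.toAddMonoidHom)
      Finset.univ a₀ a₁ e a
    have h0 : coord P s w a₀ = e.1 (P, s) := by rw [← hwe, coords_apply]
    rw [h0]
    exact this.symm
  obtain ⟨w, hw, h1, h2⟩ := hyV
  refine ⟨w, hw, fun l hl P s a _ ha => h1 l hl P s a ha, fun P s a ha => ⟨fun hao => ?_, fun hao => ?_⟩⟩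
  · rw [h2 P s a ha, hy a hao, coords_apply]
  · rw [h2 P s a ha, hy' a hao]
    rfl

/-- An equivariant subspace contains every vector whose coefficients at each ordered tuple are
also those of some element of the subspace. -/
theorem IsHomogeneousOver.mem_of_forall_coord [Finite U] [Finite Q]
    (hG : Γ.IsHomogeneousOver S G) {W : Submodule F ((Fin d → A) →₀ F)}
    (hW : IsEquivariantSubspace G W) (v : (Fin d → A) →₀ F)
    (hv : ∀ k ≤ d, ∀ a : Fin k → A, (∀ i, a i ∉ S) → StrictMono a →
      ∃ w ∈ W, ∀ P (s : Fin k → Fin d), coord (G := G) P s w a = coord P s v a) : v ∈ W := by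
  classical
  -- All lengths `0, …, d` have to be cleared, hence the bound `d + 1`.
  suffices h : ∀ m ≤ d + 1, ∃ w ∈ W, ∀ l < m, ∀ P (s : Fin l → Fin d) (a : Fin l → A),
      (∀ i, a i ∉ S) → StrictMono a → coord (G := G) P s (v - w) a = 0 by
    obtain ⟨w, hw, h⟩ := h (d + 1) le_rfl
    have := hG.eq_zero_of_coord (v - w) fun k hk => h k (Nat.lt_succ_of_le hk)
    rw [sub_eq_zero.1 this]
    exact hw
  intro m
  induction m with
  | zero => exact fun _ => ⟨0, zero_mem _, by simp⟩
  | succ m ih =>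
    intro hm
    obtain ⟨w, hw, h⟩ := ih (Nat.le_of_succ_le hm)
    have := hG.finite_quotient (Fin m)
    have := Fintype.ofFinite (MulAction.orbitRel.Quotient G (Fin m → A))
    have hex : ∀ R : MulAction.orbitRel.Quotient G (Fin m → A), ∃ w' ∈ W,
        (∀ l < m, ∀ P (s : Fin l → Fin d) (a : Fin l → A), (∀ i, a i ∉ S) → StrictMono a →
          coord (G := G) P s w' a = 0) ∧
        ∀ P (s : Fin m → Fin d) (a : Fin m → A), (∀ i, a i ∉ S) → StrictMono a →
          coord (G := G) P s w' a = if Quotient.mk _ a = R then coord P s (v - w) a else 0 := by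
      intro R
      have hR : ∀ a, Quotient.mk _ a = R ↔ a ∈ MulAction.orbit G R.out := by
        intro a
        conv_lhs => rw [← Quotient.out_eq R]
        exact ⟨Quotient.exact, fun h => Quotient.sound h⟩
      by_cases ho : (∀ i, R.out i ∉ S) ∧ StrictMono R.out
      · obtain ⟨w', hw', h1, h2⟩ := hG.exists_coord_eq_on_orbit hW ho.2 ho.1 h (by
          intro a haS ha
          obtain ⟨w', hw', h'⟩ := hv m (Nat.le_of_succ_le_succ hm) a haS ha
          exact ⟨w' - w, sub_mem hw' hw, fun P s => by simp [h' P s]⟩)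
        refine ⟨w', hw', h1, fun P s a _ ha => ?_⟩
        split_ifs with haR
        · exact (h2 P s a ha).1 ((hR a).1 haR)
        · exact (h2 P s a ha).2 (mt (hR a).2 haR)
      · refine ⟨0, zero_mem _, by simp, fun P s a haS ha => ?_⟩
        rw [if_neg, map_zero, Finsupp.zero_apply]
        intro haR
        exact ho ((isOrdered_iff_of_mem_orbit hG ((hR a).1 haR)).1 ⟨haS, ha⟩)
    choose w' hw' h1 h2 using hex
    refine ⟨w + ∑ R, w' R, add_mem hw (Submodule.sum_mem _ fun R _ => hw' R), ?_⟩
    intro l hl P s a haS ha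
    rw [← sub_sub, map_sub, Finsupp.sub_apply, map_sum, Finsupp.finsetSum_apply]
    rcases Nat.lt_succ_iff_lt_or_eq.1 hl with hl | rfl
    · rw [h l hl P s a haS ha, Finset.sum_eq_zero fun R _ => h1 R l hl P s a haS ha, sub_zero]
    · rw [Finset.sum_congr rfl fun R _ => h2 R P s a haS ha]
      simp

omit [Finite (MulAction.orbitRel.Quotient G (Fin d → A))] in
/-- Equivariant subspaces are determined by finitely many restrictions to ordered orbits. -/
theorem IsHomogeneousOver.exists_restrictions [Finite U] [Finite Q]
    (hG : Γ.IsHomogeneousOver S G) :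
    ∃ (t : ℕ) (k n : Fin t → ℕ) (o : ∀ i, Fin (k i) → A)
      (r : ∀ i, ((Fin d → A) →₀ F) →ₗ[F] (MulAction.orbit G (o i) →₀ (Fin (n i) → F))),
      (∀ i, k i ≤ d) ∧ (∀ i, (∀ j, o i j ∉ S) ∧ StrictMono (o i)) ∧
      (∀ i, IsEquivariantMap G (r i)) ∧
      ∀ W : Submodule F ((Fin d → A) →₀ F), IsEquivariantSubspace G W →
        ∃ E : ∀ i, Submodule F (Fin (n i) → F),
          (∀ i, (E i : Set (Fin (n i) → F)) = {x | ∃ w ∈ W, ∃ b, r i w b = x}) ∧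
          (W : Set ((Fin d → A) →₀ F)) = {v | ∀ i, ∀ a, r i v a ∈ E i} := by
  have hfin := fun k : ℕ => hG.finite_quotient (Fin k)
  -- One restriction for each ordered orbit of length at most `d`, including the empty tuple, where
  -- the coefficients on each orbit are summed.
  let ι := Σ k : Fin (d + 1), {P : MulAction.orbitRel.Quotient G (Fin k → A) //
    (∀ j, P.out j ∉ S) ∧ StrictMono P.out}
  let e : Fin (Nat.card ι) ≃ ι := (Finite.equivFin ι).symm
  let n : ℕ → ℕ := fun k => Nat.card (MulAction.orbitRel.Quotient G (Fin d → A) × (Fin k → Fin d))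
  let c : ∀ k, Fin (n k) ≃ MulAction.orbitRel.Quotient G (Fin d → A) × (Fin k → Fin d) :=
    fun k => (Finite.equivFin _).symm
  let r : ∀ (k : ℕ) (o : Fin k → A), ((Fin d → A) →₀ F) →ₗ[F]
      (MulAction.orbit G o →₀ (Fin (n k) → F)) := fun k o =>
    Finsupp.lsubtypeDomain (MulAction.orbit G o) ∘ₗ
      Finsupp.mapRange.linearMap (LinearMap.funLeft F F (c k)) ∘ₗ coords G F d k
  have hr : ∀ k o v b q, r k o v b q = coord (c k q).1 (c k q).2 v b.1 := by
    intro k o v b q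
    change coords G F d k v b.1 (c k q) = _
    rw [coords_apply]
  have hequiv : ∀ k o, IsEquivariantMap G (r k o) := by
    intro k o g v
    ext b q
    rw [hr, coord_linAct, linAct_apply, linAct_apply, hr]
    rfl
  have hmove : ∀ (W : Submodule F ((Fin d → A) →₀ F)), IsEquivariantSubspace G W → ∀ k o b b',
      ∀ w ∈ W, ∃ w' ∈ W, r k o w' b' = r k o w b := by
    intro W hW k o b b' w hw
    obtain ⟨g, rfl⟩ := MulAction.exists_smul_eq G b b'
    exact ⟨linAct F F g w, hW g w hw, by rw [hequiv, linAct_apply_smul]⟩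
  refine ⟨Nat.card ι, fun i => (e i).1, fun i => n (e i).1, fun i => (e i).2.1.out,
    fun i => r (e i).1 (e i).2.1.out, fun i => Nat.le_of_lt_succ (e i).1.2, fun i => (e i).2.2,
    fun i => hequiv _ _, fun W hW => ?_⟩
  have hE : ∀ i, ((W.map (Finsupp.lapply ⟨(e i).2.1.out, MulAction.mem_orbit_self _⟩ ∘ₗ
      r (e i).1 (e i).2.1.out) : Submodule F (Fin (n (e i).1) → F)) : Set (Fin (n (e i).1) → F)) =
      {x | ∃ w ∈ W, ∃ b, r (e i).1 (e i).2.1.out w b = x} := by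
    intro i
    ext x
    constructor
    · rintro ⟨w, hw, rfl⟩
      exact ⟨w, hw, _, rfl⟩
    · rintro ⟨w, hw, b, rfl⟩
      obtain ⟨w', hw', h⟩ := hmove W hW _ _ b ⟨(e i).2.1.out, MulAction.mem_orbit_self _⟩ w hw
      exact ⟨w', hw', h⟩
  refine ⟨_, hE, Set.Subset.antisymm ?_ ?_⟩
  · intro v hv i a
    rw [← SetLike.mem_coe, hE i]
    exact ⟨v, hv, a, rfl⟩
  · intro v hv
    refine hG.mem_of_forall_coord hW v fun k hk a haS ha => ?_
    let R : MulAction.orbitRel.Quotient G (Fin k → A) := Quotient.mk _ a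
    have haR : a ∈ MulAction.orbit G R.out := Quotient.exact (Quotient.out_eq R).symm
    have hi : ∃ i, e i = ⟨⟨k, Nat.lt_succ_of_le hk⟩, ⟨R, (isOrdered_iff_of_mem_orbit hG haR).1 ⟨haS, ha⟩⟩⟩ :=
      e.surjective _
    obtain ⟨i, hi⟩ := hi
    have hvi : ∀ b, ∃ w ∈ W, ∃ b', r (e i).1 (e i).2.1.out w b' = r (e i).1 (e i).2.1.out v b := by
      intro b
      have := hv i b
      rwa [← SetLike.mem_coe, hE i] at this
    rw [hi] at hvi
    obtain ⟨w, hw, b, hb⟩ := hvi ⟨a, haR⟩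
    obtain ⟨w', hw', h'⟩ := hmove W hW _ _ b ⟨a, haR⟩ w hw
    refine ⟨w', hw', fun P s => ?_⟩
    have := congrFun (h'.trans hb) ((c k).symm (P, s))
    rw [hr, hr] at this
    simpa using this

end GenericColoring

/-! ### Free amalgamation classes are determined by cliques. -/

namespace OrderedFreeAmalgamation

section Relational

variable {L : FirstOrder.Language.{u, v}} [L.IsRelational]

omit [L.IsRelational] in
theorem relMap_one_iff {M : Type*} [L.Structure M] (R : L.Relations 1) (x : Fin 1 → M) :
    Structure.RelMap R x ↔ Structure.RelMap R ![x 0] := by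
  rw [show x = ![x 0] from funext fun i => by fin_cases i; rfl]
  rfl

omit [L.IsRelational] in
theorem relMap_two_iff {M : Type*} [L.Structure M] (R : L.Relations 2) (x : Fin 2 → M) :
    Structure.RelMap R x ↔ Structure.RelMap R ![x 0, x 1] := by
  rw [show x = ![x 0, x 1] from funext fun i => by fin_cases i <;> rfl]
  rfl

/-- An injective map that preserves and reflects unary and binary relations is an embedding. -/
theorem exists_embedding_eq {M N : Type*} [L.Structure M] [L.Structure N]
    (hL : ∀ n, n ≠ 1 → n ≠ 2 → IsEmpty (L.Relations n)) (f : M → N) (hf : Function.Injective f)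
    (h₁ : ∀ (R : L.Relations 1) x, Structure.RelMap R ![f x] ↔ Structure.RelMap R ![x])
    (h₂ : ∀ (R : L.Relations 2) x y, Structure.RelMap R ![f x, f y] ↔ Structure.RelMap R ![x, y]) :
    ∃ g : M ↪[L] N, ∀ x, g x = f x := by
  refine ⟨⟨⟨f, hf⟩, fun φ => isEmptyElim φ, fun {n} R x => ?_⟩, fun _ => rfl⟩
  by_cases hn₁ : n = 1
  · subst hn₁
    rw [relMap_one_iff R x, relMap_one_iff R _]
    exact h₁ R _
  by_cases hn₂ : n = 2
  · subst hn₂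
    rw [relMap_two_iff R x, relMap_two_iff R _]
    exact h₂ R _ _
  exact ((hL n hn₁ hn₂).false R).elim

variable (L) in
/-- Every subset of a relational structure is a substructure. -/
def inducedOn {M : Type*} [L.Structure M] (C : Set M) : L.Substructure M :=
  ⟨C, fun f => isEmptyElim f⟩

omit [L.IsRelational] in
theorem relMap_inducedOn_one {M : Type*} [L.Structure M] {C : L.Substructure M} (R : L.Relations 1)
    (x : C) : Structure.RelMap R ![x] ↔ Structure.RelMap R ![(x : M)] :=
  relMap_one_iff R fun i => ((![x] : Fin 1 → C) i : M)

omit [L.IsRelational] in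
theorem relMap_inducedOn_two {M : Type*} [L.Structure M] {C : L.Substructure M} (R : L.Relations 2)
    (x y : C) : Structure.RelMap R ![x, y] ↔ Structure.RelMap R ![(x : M), (y : M)] :=
  relMap_two_iff R fun i => ((![x, y] : Fin 2 → C) i : M)

omit [L.IsRelational] in
theorem mem_of_embedding {K : Set (Bundled.{w} L.Structure)} (hK : IsFreeAmalgamationClass K)
    {M N : Type w} [L.Structure M] [L.Structure N] (f : M ↪[L] N)
    (hN : (⟨N, inferInstance⟩ : Bundled.{w} L.Structure) ∈ K) :
    (⟨M, inferInstance⟩ : Bundled.{w} L.Structure) ∈ K := by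
  have : Finite N := hK.finite _ hN
  have : Finite M := Finite.of_injective f f.injective
  exact hK.hereditary _ hN ⟨Structure.FG.of_finite, ⟨f⟩⟩

/-- A finite structure belongs to a free amalgamation class as soon as its complete induced
substructures do. -/
theorem IsFreeAmalgamationClass.mem_of_cliques {K : Set (Bundled.{w} L.Structure)}
    (hK : IsFreeAmalgamationClass K) (hL : ∀ n, n ≠ 1 → n ≠ 2 → IsEmpty (L.Relations n))
    {A : Type w} [L.Structure A]
    (hA : ∀ s : Set A, s.Finite → (⟨inducedOn L s, inferInstance⟩ : Bundled.{w} L.Structure) ∈ K)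
    {M : Type w} [L.Structure M] [Finite M]
    (h : ∀ C : Set M, (∀ x ∈ C, ∀ y ∈ C, x ≠ y → ∃ R : L.Relations 2,
        Structure.RelMap R ![x, y] ∨ Structure.RelMap R ![y, x]) →
      ∃ f : M → A, Set.InjOn f C ∧
        (∀ x ∈ C, ∀ R : L.Relations 1, Structure.RelMap R ![f x] ↔ Structure.RelMap R ![x]) ∧
        ∀ x ∈ C, ∀ y ∈ C, ∀ R : L.Relations 2,
          Structure.RelMap R ![f x, f y] ↔ Structure.RelMap R ![x, y]) :
    (⟨M, inferInstance⟩ : Bundled.{w} L.Structure) ∈ K := by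
  classical
  have key : ∀ (n : ℕ) (C : Set M), C.ncard = n →
      (⟨inducedOn L C, inferInstance⟩ : Bundled.{w} L.Structure) ∈ K := by
    intro n
    induction n using Nat.strong_induction_on with
    | _ n ih =>
      intro C hC
      by_cases hclique : ∀ x ∈ C, ∀ y ∈ C, x ≠ y → ∃ R : L.Relations 2,
        Structure.RelMap R ![x, y] ∨ Structure.RelMap R ![y, x]
      · obtain ⟨f, hinj, h₁, h₂⟩ := h C hclique
        obtain ⟨g, -⟩ := exists_embedding_eq (L := L) (M := inducedOn L C)
          (N := inducedOn L (f '' C)) hL (fun x => ⟨f x, x, x.2, rfl⟩)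
          (fun x y hxy => Subtype.ext (hinj x.2 y.2 (congrArg Subtype.val hxy)))
          (fun R x => by
            rw [relMap_inducedOn_one, relMap_inducedOn_one]
            exact h₁ x x.2 R)
          (fun R x y => by
            rw [relMap_inducedOn_two, relMap_inducedOn_two]
            exact h₂ x x.2 y y.2 R)
        exact mem_of_embedding hK g (hA _ ((Set.toFinite C).image f))
      -- For unrelated `x ≠ y`, the structure on `C` is the free amalgam of those on `C \ {x}` and
      -- `C \ {y}` over `C \ {x, y}`, both smaller.
      · push Not at hclique
        obtain ⟨x, hx, y, hy, hxy, hno⟩ := hclique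
        have hlt : ∀ p ∈ C, (C \ {p}).ncard < n := fun p hp => by
          rw [← hC]
          exact Set.ncard_sdiff_singleton_lt_of_mem hp
        have hle₁ : inducedOn L (C \ {x, y}) ≤ inducedOn L (C \ {x}) := fun p hp =>
          ⟨hp.1, fun h => hp.2 (Or.inl h)⟩
        have hle₂ : inducedOn L (C \ {x, y}) ≤ inducedOn L (C \ {y}) := fun p hp =>
          ⟨hp.1, fun h => hp.2 (Or.inr h)⟩
        have hY₁ := ih _ (hlt x hx) _ rfl
        have hY₂ := ih _ (hlt y hy) _ rfl
        have hX := mem_of_embedding hK (Substructure.inclusion hle₁) hY₁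
        obtain ⟨Z, g₁, g₂, hZ, hfree⟩ := hK.freeAmalgamation _ _ _ (Substructure.inclusion hle₁)
          (Substructure.inclusion hle₂) hX hY₁ hY₂
        have hg : ∀ (p : M) (h₁ : p ∈ C \ {x}) (h₂ : p ∈ C \ {y}),
            g₁ ⟨p, h₁⟩ = g₂ ⟨p, h₂⟩ := fun p h₁ h₂ =>
          hfree.comm ⟨p, h₁.1, fun h => h.elim (fun h => h₁.2 h) fun h => h₂.2 h⟩
        have hx₂ : x ∈ C \ {y} := ⟨hx, hxy⟩
        have hy₁ : y ∈ C \ {x} := ⟨hy, hxy.symm⟩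
        have hxr : ∀ p, g₁ p ≠ g₂ ⟨x, hx₂⟩ := by
          intro p hp
          obtain ⟨e, -, he⟩ := hfree.inter _ _ hp
          exact e.2.2 (Or.inl (congrArg Subtype.val he))
        have hyr : ∀ p, g₁ ⟨y, hy₁⟩ ≠ g₂ p := by
          intro p hp
          obtain ⟨e, he, -⟩ := hfree.inter _ _ hp
          exact e.2.2 (Or.inr (congrArg Subtype.val he))
        let f : inducedOn L C → Z := fun p =>
          if hp : (p : M) = x then g₂ ⟨x, hx₂⟩ else g₁ ⟨p, p.2, hp⟩
        have hf₁ : ∀ (p : inducedOn L C) (hp : (p : M) ≠ x), f p = g₁ ⟨p, p.2, hp⟩ :=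
          fun p hp => dif_neg hp
        have hf₂ : ∀ (p : inducedOn L C) (hp : (p : M) ≠ y), f p = g₂ ⟨p, p.2, hp⟩ := by
          intro p hp
          by_cases hpx : (p : M) = x
          · simp only [f, dif_pos hpx, hpx]
          · rw [hf₁ p hpx]
            exact hg p _ _
        have hcase : ∀ p q : inducedOn L C, ((p : M) ≠ x ∧ (q : M) ≠ x) ∨ ((p : M) ≠ y ∧ (q : M) ≠ y) ∨
            ((p : M) = x ∧ (q : M) = y) ∨ ((p : M) = y ∧ (q : M) = x) := by
          intro p q
          by_cases h1 : (p : M) = x <;> by_cases h2 : (q : M) = x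
          · right; left; rw [h1, h2]; exact ⟨hxy, hxy⟩
          · by_cases h3 : (q : M) = y
            · tauto
            · right; left; rw [h1]; exact ⟨hxy, h3⟩
          · by_cases h3 : (p : M) = y
            · tauto
            · right; left; rw [h2]; exact ⟨h3, hxy⟩
          · tauto
        have hfx : ∀ p : inducedOn L C, (p : M) = x → f p = g₂ ⟨x, hx₂⟩ := fun p hp => dif_pos hp
        have hfy : ∀ p : inducedOn L C, (p : M) = y → f p = g₁ ⟨y, hy₁⟩ := by
          intro p hp
          rw [hf₁ p (hp ▸ hxy.symm)]
          congr 1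
          exact Subtype.ext hp
        obtain ⟨g, -⟩ := exists_embedding_eq (L := L) hL f (by
            intro p q hpq
            rcases hcase p q with ⟨h1, h2⟩ | ⟨h1, h2⟩ | ⟨h1, h2⟩ | ⟨h1, h2⟩
            · rw [hf₁ p h1, hf₁ q h2] at hpq
              exact Subtype.ext (Subtype.mk.inj (g₁.injective hpq))
            · rw [hf₂ p h1, hf₂ q h2] at hpq
              exact Subtype.ext (Subtype.mk.inj (g₂.injective hpq))
            · rw [hfx p h1, hfy q h2] at hpq
              exact (hxr _ hpq.symm).elim
            · rw [hfx q h2, hfy p h1] at hpq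
              exact (hxr _ hpq).elim) (by
            intro R p
            have h₁' : ∀ q, Structure.RelMap R ![g₁ q] ↔ Structure.RelMap R ![q] := fun q => by
              rw [← g₁.map_rel R ![q], relMap_one_iff R (g₁ ∘ ![q])]
              rfl
            have h₂' : ∀ q, Structure.RelMap R ![g₂ q] ↔ Structure.RelMap R ![q] := fun q => by
              rw [← g₂.map_rel R ![q], relMap_one_iff R (g₂ ∘ ![q])]
              rfl
            rcases hcase p p with ⟨h1, -⟩ | ⟨h1, -⟩ | ⟨h1, h2⟩ | ⟨h1, h2⟩
            · rw [hf₁ p h1, h₁', relMap_inducedOn_one, relMap_inducedOn_one]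
            · rw [hf₂ p h1, h₂', relMap_inducedOn_one, relMap_inducedOn_one]
            · exact (hxy (h1.symm.trans h2)).elim
            · exact (hxy (h2.symm.trans h1)).elim) (by
            intro R p q
            have h₁' : ∀ p q, Structure.RelMap R ![g₁ p, g₁ q] ↔ Structure.RelMap R ![p, q] :=
              fun p q => by
                rw [← g₁.map_rel R ![p, q], relMap_two_iff R (g₁ ∘ ![p, q])]
                rfl
            have h₂' : ∀ p q, Structure.RelMap R ![g₂ p, g₂ q] ↔ Structure.RelMap R ![p, q] :=
              fun p q => by
                rw [← g₂.map_rel R ![p, q], relMap_two_iff R (g₂ ∘ ![p, q])]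
                rfl
            rcases hcase p q with ⟨h1, h2⟩ | ⟨h1, h2⟩ | ⟨h1, h2⟩ | ⟨h1, h2⟩
            · rw [hf₁ p h1, hf₁ q h2, h₁', relMap_inducedOn_two, relMap_inducedOn_two]
            · rw [hf₂ p h1, hf₂ q h2, h₂', relMap_inducedOn_two, relMap_inducedOn_two]
            · rw [hfx p h1, hfy q h2, relMap_inducedOn_two, h1, h2]
              refine iff_of_false (fun hR => ?_) (hno R).1
              rcases hfree.rel 2 R _ hR with h | h
              · obtain ⟨e, he⟩ := h 0
                exact hxr e he
              · obtain ⟨e, he⟩ := h 1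
                exact hyr e he.symm
            · rw [hfx q h2, hfy p h1, relMap_inducedOn_two, h1, h2]
              refine iff_of_false (fun hR => ?_) (hno R).2
              rcases hfree.rel 2 R _ hR with h | h
              · obtain ⟨e, he⟩ := h 1
                exact hxr e he
              · obtain ⟨e, he⟩ := h 0
                exact hyr e he.symm)
        exact mem_of_embedding hK g hZ
  obtain ⟨g, -⟩ := exists_embedding_eq (L := L) (M := M) (N := inducedOn L (Set.univ : Set M)) hL
    (fun x => ⟨x, trivial⟩) (fun x y hxy => congrArg Subtype.val hxy)
    (fun R x => relMap_inducedOn_one R _) (fun R x y => relMap_inducedOn_two R _ _)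
  exact mem_of_embedding hK g (key _ _ rfl)

/-- The relational structure with given unary and binary relations. -/
@[reducible] def binaryStructure {M : Type*} (P : L.Relations 1 → M → Prop)
    (R : L.Relations 2 → M → M → Prop) : L.Structure M where
  funMap f := isEmptyElim f
  RelMap {n} := match n with
    | 1 => fun S x => P S (x 0)
    | 2 => fun S x => R S (x 0) (x 1)
    | _ => fun _ _ => False

/-- The structure over `{<}` given by a binary relation. -/
@[reducible] def ltStructure {M : Type*} (r : M → M → Prop) : ltLanguage.Structure M where
  funMap f := isEmptyElim f
  RelMap {n} S := match n, S with
    | _, LtSymbol.lt => fun x => r (x 0) (x 1)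

end Relational

end OrderedFreeAmalgamation

/-! ### The ordered Fraïssé limit as a generic colouring. -/

namespace OrderedFreeAmalgamation

section Limit

variable {L : FirstOrder.Language.{u, v}} [L.IsRelational]

/-- The interpretation of a unary symbol of `L` in an ordered structure. -/
abbrev unaryRel {M : Type*} [(withLt L).Structure M] (R : L.Relations 1) (a : M) : Prop :=
  Structure.RelMap (L := withLt L) (Sum.inl R : (withLt L).Relations 1) ![a]

/-- The interpretation of a binary symbol of `L` in an ordered structure. -/
abbrev binaryRel {M : Type*} [(withLt L).Structure M] (R : L.Relations 2) (a b : M) : Prop :=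
  Structure.RelMap (L := withLt L) (Sum.inl R : (withLt L).Relations 2) ![a, b]

omit [L.IsRelational] in
theorem isEmpty_withLt_relations (hL : ∀ n, n ≠ 1 → n ≠ 2 → IsEmpty (L.Relations n)) (n : ℕ)
    (h₁ : n ≠ 1) (h₂ : n ≠ 2) : IsEmpty ((withLt L).Relations n) := by
  constructor
  rintro (R | R)
  · exact (hL n h₁ h₂).false R
  · cases R
    exact h₂ rfl

/-- A map that is compatible with the unary and binary relations of `L` and with `<` is an embedding
of ordered structures. -/
theorem exists_withLt_embedding_eq {M N : Type*} [(withLt L).Structure M] [(withLt L).Structure N]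
    (hL : ∀ n, n ≠ 1 → n ≠ 2 → IsEmpty (L.Relations n)) (f : M → N) (hf : Function.Injective f)
    (h₁ : ∀ (R : L.Relations 1) x, unaryRel R (f x) ↔
      unaryRel R x)
    (h₂ : ∀ (R : L.Relations 2) x y,
      binaryRel R (f x) (f y) ↔
      binaryRel R x y)
    (h₃ : ∀ x y, ltRel L (f x) (f y) ↔ ltRel L x y) :
    ∃ g : M ↪[withLt L] N, ∀ x, g x = f x := by
  refine exists_embedding_eq (isEmpty_withLt_relations hL) f hf ?_ ?_
  · rintro (R | R) x
    · exact h₁ R x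
    · cases R
  · rintro (R | R) x y
    · exact h₂ R x y
    · cases R
      exact h₃ x y

variable {K : Set (Bundled.{w} L.Structure)} {A : Type w} [(withLt L).Structure A]

theorem inducedOn_mem_orderedExpansions (hA : (withLt L).age A = orderedExpansions K) {s : Set A}
    (hs : s.Finite) :
    (⟨inducedOn (withLt L) s, inferInstance⟩ : Bundled.{w} (withLt L).Structure) ∈
      orderedExpansions K := by
  have : Finite (inducedOn (withLt L) s) := hs
  rw [← hA]
  exact ⟨Structure.FG.of_finite, ⟨(inducedOn (withLt L) s).subtype⟩⟩

theorem inducedOn_reduct_mem (hK : IsFreeAmalgamationClass K)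
    (hL : ∀ n, n ≠ 1 → n ≠ 2 → IsEmpty (L.Relations n))
    (hA : (withLt L).age A = orderedExpansions K) {s : Set A} (hs : s.Finite) :
    letI : L.Structure A := (LHom.sumInl : L →ᴸ withLt L).reduct A
    (⟨inducedOn L s, inferInstance⟩ : Bundled.{w} L.Structure) ∈ K := by
  let _ : L.Structure A := (LHom.sumInl : L →ᴸ withLt L).reduct A
  let _ : L.Structure (inducedOn (withLt L) s) :=
    (LHom.sumInl : L →ᴸ withLt L).reduct (inducedOn (withLt L) s)
  obtain ⟨g, -⟩ := exists_embedding_eq (L := L) (M := inducedOn L s)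
    (N := inducedOn (withLt L) s) hL (fun x => ⟨x, x.2⟩)
    (fun x y hxy => Subtype.ext (Subtype.mk.inj hxy))
    (fun R x => Iff.trans (relMap_inducedOn_one (L := withLt L) (Sum.inl R) _)
      (relMap_inducedOn_one (L := L) R x).symm)
    (fun R x y => Iff.trans (relMap_inducedOn_two (L := withLt L) (Sum.inl R) _ _)
      (relMap_inducedOn_two (L := L) R x y).symm)
  exact mem_of_embedding hK g (inducedOn_mem_orderedExpansions hA hs).1

omit [L.IsRelational] in
theorem ltRel_inducedOn {C : (withLt L).Substructure A} (x y : C) :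
    ltRel L x y ↔ ltRel L (x : A) (y : A) :=
  relMap_inducedOn_two (L := withLt L) _ x y

/-- Each order axiom involves at most three points, hence is inherited from finite induced
substructures. -/
theorem isStrictTotalOrder_of_age (hA : (withLt L).age A = orderedExpansions K) :
    IsStrictTotalOrder A (ltRel L) := by
  have h := fun a b c : A => (inducedOn_mem_orderedExpansions hA (Set.toFinite {a, b, c})).2
  have ha : ∀ a b c : A, a ∈ ({a, b, c} : Set A) := fun a b c => by simp
  have hb : ∀ a b c : A, b ∈ ({a, b, c} : Set A) := fun a b c => by simp
  have hc : ∀ a b c : A, c ∈ ({a, b, c} : Set A) := fun a b c => by simp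
  refine { trichotomous := ?_, irrefl := ?_, trans := ?_ }
  · intro a b h₁ h₂
    have := h a b b
    have h' := this.toTrichotomous.trichotomous (⟨a, ha a b b⟩ : inducedOn (withLt L) {a, b, b})
      ⟨b, hb a b b⟩ (fun h' => h₁ ((ltRel_inducedOn _ _).1 h'))
      (fun h' => h₂ ((ltRel_inducedOn _ _).1 h'))
    exact congrArg Subtype.val h'
  · intro a h₁
    have := h a a a
    exact this.toIsStrictOrder.toIrrefl.irrefl (⟨a, ha a a a⟩ : inducedOn (withLt L) {a, a, a})
      ((ltRel_inducedOn _ _).2 h₁)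
  · intro a b c h₁ h₂
    have := h a b c
    exact (ltRel_inducedOn _ _).1 (this.toIsStrictOrder.toIsTrans.trans
      (⟨a, ha a b c⟩ : inducedOn (withLt L) {a, b, c}) ⟨b, hb a b c⟩ ⟨c, hc a b c⟩
      ((ltRel_inducedOn _ _).2 h₁) ((ltRel_inducedOn _ _).2 h₂))

theorem irrefl_of_age (hIrr : IsIrreflexiveClass K)
    (hA : (withLt L).age A = orderedExpansions K) (R : L.Relations 2) (a : A) :
    ¬ binaryRel R a a := by
  intro h
  have h₁ := (inducedOn_mem_orderedExpansions hA (Set.toFinite {a})).1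
  exact hIrr _ h₁ R (⟨a, rfl⟩ : inducedOn (withLt L) {a}) ⟨a, rfl⟩
    ((relMap_inducedOn_two (L := withLt L) (Sum.inl R) _ _).2 h) rfl

variable (A) in
/-- The structure `A` with one more point, given by its relations to the points of `A` and a cut,
restricted to a finite subset of `A` and the new point. -/
@[reducible] def onePointStructure (B : Finset A) (ν : L.Relations 1 → Prop)
    (f g : A → L.Relations 2 → Prop) : L.Structure (Option B) :=
  binaryStructure
    (fun R x => match x with
      | none => ν R
      | some b => unaryRel R (b : A))
    (fun R x y => match x, y with
      | none, none => False
      | none, some b => f b R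
      | some b, none => g b R
      | some b, some b' => binaryRel R (b : A) (b' : A))

variable [LinearOrder A]

/-- The order on the one-point extension. -/
def onePointLt (B : Finset A) (lo : A → Prop) (x y : Option B) : Prop :=
  match x, y with
  | none, none => False
  | none, some b => ¬ lo b
  | some b, none => lo b
  | some b, some b' => (b : A) < b'

theorem isStrictTotalOrder_onePointLt {B : Finset A} {lo : A → Prop}
    (hlo : ∀ b ∈ B, ∀ b' ∈ B, b < b' → lo b' → lo b) :
    IsStrictTotalOrder (Option B) (onePointLt B lo) := by
  refine { trichotomous := ?_, irrefl := ?_, trans := ?_ }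
  · rintro (_ | b) (_ | b') h₁ h₂
    · rfl
    · exact (h₂ (not_not.1 h₁)).elim
    · exact (h₁ (not_not.1 h₂)).elim
    · exact congrArg some (Subtype.ext (le_antisymm (not_lt.1 h₂) (not_lt.1 h₁)))
  · rintro (_ | b) h
    · exact h
    · exact lt_irrefl (b : A) h
  · rintro (_ | a) (_ | b) (_ | c) h₁ h₂
    · exact h₁
    · exact h₂
    · exact h₁ h₂
    · exact fun h => h₁ (hlo b b.2 c c.2 h₂ h)
    · exact h₁
    · by_contra h
      rcases (not_lt.1 h).eq_or_lt with h' | h'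
      · exact h₂ (h' ▸ h₁)
      · exact h₂ (hlo c c.2 a a.2 h' h₁)
    · exact hlo a a.2 b b.2 h₁ h₂
    · exact lt_trans (a := (a : A)) h₁ h₂

/-- By `mem_of_cliques` only cliques matter. Those through the new point are realised by hypothesis,
the others lie in `A` already. The realisation is injective by irreflexivity: related points with a
common image would give a loop. -/
theorem onePointStructure_mem (hK : IsFreeAmalgamationClass K) (hIrr : IsIrreflexiveClass K)
    (hL : ∀ n, n ≠ 1 → n ≠ 2 → IsEmpty (L.Relations n))
    (hA : (withLt L).age A = orderedExpansions K) (B : Finset A) (ν : L.Relations 1 → Prop)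
    (f g : A → L.Relations 2 → Prop)
    (h : ∀ C ⊆ B, (∀ b ∈ C, f b ≠ (fun _ => False) ∨ g b ≠ (fun _ => False)) →
      (∀ b ∈ C, ∀ b' ∈ C, b ≠ b' → ∃ R : L.Relations 2,
        binaryRel R b b' ∨
        binaryRel R b' b) →
      ∃ (y : A) (φ : A → A),
        (∀ R : L.Relations 1, unaryRel R y ↔ ν R) ∧
        ∀ b ∈ C, (∀ R : L.Relations 1, unaryRel R (φ b) ↔
            unaryRel R b) ∧
          (∀ R : L.Relations 2, binaryRel R y (φ b) ↔ f b R) ∧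
          (∀ R : L.Relations 2, binaryRel R (φ b) y ↔ g b R) ∧
          ∀ b' ∈ C, b ≠ b' → ∀ R : L.Relations 2,
            (binaryRel R (φ b) (φ b') ↔
              binaryRel R b b')) :
    (⟨Option B, onePointStructure A B ν f g⟩ : Bundled.{w} L.Structure) ∈ K := by
  classical
  let _ : L.Structure A := (LHom.sumInl : L →ᴸ withLt L).reduct A
  let _ : L.Structure (Option B) := onePointStructure A B ν f g
  have hirr := irrefl_of_age hIrr hA
  refine hK.mem_of_cliques hL (A := A) (fun s hs => inducedOn_reduct_mem hK hL hA hs) ?_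
  intro C hC
  have hCB : ∀ b b' : B, some b ∈ C → some b' ∈ C → b ≠ b' → ∃ R : L.Relations 2,
        binaryRel R (b : A) (b' : A) ∨
        binaryRel R (b' : A) (b : A) :=
    fun b b' hb hb' hne => hC _ hb _ hb' (fun h' => hne (Option.some.inj h'))
  by_cases hnone : (none : Option B) ∈ C
  · obtain ⟨y, φ, hy, hφ⟩ := h (B.attach.filter (fun b => some b ∈ C) |>.image Subtype.val)
      (by
        intro b hb
        obtain ⟨b', -, rfl⟩ := Finset.mem_image.1 hb
        exact b'.2)
      (by
        intro b hb
        obtain ⟨b', hb', rfl⟩ := Finset.mem_image.1 hb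
        obtain ⟨R, hR⟩ := hC _ hnone _ (Finset.mem_filter.1 hb').2 (by simp)
        rcases hR with hR | hR
        · left
          intro h0
          exact (congrFun h0 R).mp hR
        · right
          intro h0
          exact (congrFun h0 R).mp hR)
      (by
        intro b hb b' hb' hne
        obtain ⟨c, hc, rfl⟩ := Finset.mem_image.1 hb
        obtain ⟨c', hc', rfl⟩ := Finset.mem_image.1 hb'
        exact hCB c c' (Finset.mem_filter.1 hc).2 (Finset.mem_filter.1 hc').2
          (fun h' => hne (congrArg Subtype.val h')))
    have hφ' : ∀ b : B, some b ∈ C → (b : A) ∈ (B.attach.filter (fun b => some b ∈ C)).image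
        Subtype.val := fun b hb =>
      Finset.mem_image.2 ⟨b, Finset.mem_filter.2 ⟨Finset.mem_attach B b, hb⟩, rfl⟩
    have hyφ : ∀ b : B, some b ∈ C → y ≠ φ b := by
      intro b hb hyb
      obtain ⟨-, h1, h2, -⟩ := hφ b (hφ' b hb)
      obtain ⟨R, hR | hR⟩ := hC _ hnone _ hb (by simp)
      · have := (h1 R).2 hR
        rw [← hyb] at this
        exact hirr R y this
      · have := (h2 R).2 hR
        rw [← hyb] at this
        exact hirr R y this
    refine ⟨fun x => match x with
      | none => y
      | some b => φ b, ?_, ?_, ?_⟩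
    · rintro (_ | b) hx (_ | b') hx' hxx
      · rfl
      · exact (hyφ b' hx' hxx).elim
      · exact (hyφ b hx hxx.symm).elim
      · by_contra hne
        have hbb : b ≠ b' := fun h' => hne (congrArg some h')
        have hbb' : (b : A) ≠ b' := fun h' => hbb (Subtype.ext h')
        have hxx' : φ b = φ b' := hxx
        obtain ⟨R, hR | hR⟩ := hCB b b' hx hx' hbb
        · have := ((hφ b (hφ' b hx)).2.2.2 b' (hφ' b' hx') hbb' R).2 hR
          rw [hxx'] at this
          exact hirr R _ this
        · have := ((hφ b' (hφ' b' hx')).2.2.2 b (hφ' b hx) hbb'.symm R).2 hR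
          rw [hxx'] at this
          exact hirr R _ this
    · rintro (_ | b) hx R
      · exact hy R
      · exact (hφ b (hφ' b hx)).1 R
    · rintro (_ | b) hx (_ | b') hx' R
      · exact iff_of_false (hirr R y) id
      · exact (hφ b' (hφ' b' hx')).2.1 R
      · exact (hφ b (hφ' b hx)).2.2.1 R
      · by_cases hbb : b = b'
        · subst hbb
          exact iff_of_false (hirr R _) (hirr R _)
        · exact (hφ b (hφ' b hx)).2.2.2 b' (hφ' b' hx') (fun h' => hbb (Subtype.ext h')) R
  -- The value at `none` is irrelevant here; the empty clique supplies some point.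
  · obtain ⟨y, -⟩ := h ∅ (by simp) (by simp) (by simp)
    refine ⟨fun x => match x with
      | none => y
      | some b => b, ?_, ?_, ?_⟩
    · rintro (_ | b) hx (_ | b') hx' hxx
      · rfl
      · exact (hnone hx).elim
      · exact (hnone hx').elim
      · exact congrArg some (Subtype.ext hxx)
    · rintro (_ | b) hx R
      · exact (hnone hx).elim
      · exact Iff.rfl
    · rintro (_ | b) hx (_ | b') hx' R
      · exact (hnone hx).elim
      · exact (hnone hx).elim
      · exact (hnone hx').elim
      · exact Iff.rfl

variable [Countable (Σ l, (withLt L).Functions l)] [Countable A]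

/-- The colouring of the points and pairs of the Fraïssé limit by their relations. -/
def fraisseColoring (hK : IsFreeAmalgamationClass K) (hIrr : IsIrreflexiveClass K)
    (hL : ∀ n, n ≠ 1 → n ≠ 2 → IsEmpty (L.Relations n))
    (hA : IsFraisseLimit (orderedExpansions K) A) (hlt : ∀ a b : A, a < b ↔ ltRel L a b) :
    GenericColoring A (L.Relations 1 → Prop) (L.Relations 2 → Prop) where
  u a := fun R => unaryRel R a
  c a b := fun R => binaryRel R a b
  nil := fun _ => False
  irrefl a := funext fun R => eq_false (irrefl_of_age hIrr hA.age R a)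
  ext := by
    intro B ν f g lo hlo hext
    have hmem := onePointStructure_mem hK hIrr hL hA.age B ν f g (by
      intro C hCB hC hCC
      obtain ⟨y, φ, hy, hφ⟩ := hext C hCB hC (by
        intro b hb b' hb' hne
        obtain ⟨R, hR | hR⟩ := hCC b hb b' hb' hne
        · exact Or.inl fun h0 => (congrFun h0 R).mp hR
        · exact Or.inr fun h0 => (congrFun h0 R).mp hR)
      refine ⟨y, φ, fun R => Iff.of_eq (congrFun hy R), fun b hb => ?_⟩
      obtain ⟨h1, h2, h3, h4⟩ := hφ b hb
      exact ⟨fun R => Iff.of_eq (congrFun h1 R), fun R => Iff.of_eq (congrFun h2 R),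
        fun R => Iff.of_eq (congrFun h3 R),
        fun b' hb' hne R => Iff.of_eq (congrFun (h4 b' hb' hne) R)⟩)
    let _ : L.Structure (Option B) := onePointStructure A B ν f g
    let _ : ltLanguage.Structure (Option B) := ltStructure (onePointLt B lo)
    have hZ : (⟨Option B, inferInstance⟩ : Bundled.{w} (withLt L).Structure) ∈ orderedExpansions K :=
      ⟨hmem, isStrictTotalOrder_onePointLt hlo⟩
    rw [← hA.age] at hZ
    have hne := hZ.2
    have hfinB : Finite (inducedOn (withLt L) (B : Set A)) := B.finite_toSet
    obtain ⟨e, he⟩ := exists_withLt_embedding_eq (L := L) (M := inducedOn (withLt L) (B : Set A))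
      (N := Option B) hL (fun b => some ⟨b, b.2⟩)
      (fun b b' h => Subtype.ext (Subtype.mk.inj (Option.some.inj h)))
      (fun R b => (relMap_inducedOn_one (L := withLt L) (Sum.inl R) b).symm)
      (fun R b b' => (relMap_inducedOn_two (L := withLt L) (Sum.inl R) b b').symm)
      (fun b b' => (hlt _ _).trans (ltRel_inducedOn b b').symm)
    -- The one-point extension is in the age, and ultrahomogeneity provides an embedding that is the
    -- identity on `B`; the image of `none` is the desired point.
    obtain ⟨F, hF⟩ := hA.ultrahomogeneous.extend_embedding (T := Option B) (h := hne)
      Structure.FG.of_finite (inducedOn (withLt L) (B : Set A)).subtype e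
    have hFb : ∀ b (hb : b ∈ B), F (some ⟨b, hb⟩) = b := by
      intro b hb
      have := DFunLike.congr_fun hF (⟨b, hb⟩ : inducedOn (withLt L) (B : Set A))
      rw [Embedding.comp_apply, he] at this
      exact this.symm
    have h₁ : ∀ (R : (withLt L).Relations 1) x,
        Structure.RelMap R ![F x] ↔ Structure.RelMap R ![x] := fun R x => by
      rw [← F.map_rel R ![x], relMap_one_iff R (F ∘ ![x])]
      rfl
    have h₂ : ∀ (R : (withLt L).Relations 2) x y,
        Structure.RelMap R ![F x, F y] ↔ Structure.RelMap R ![x, y] := fun R x y => by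
      rw [← F.map_rel R ![x, y], relMap_two_iff R (F ∘ ![x, y])]
      rfl
    refine ⟨F none, ?_, ?_, ?_⟩
    · intro hB
      have := F.injective (hFb _ hB)
      exact Option.some_ne_none _ this
    · exact funext fun R => propext (h₁ (Sum.inl R) none)
    · intro b hb
      refine ⟨funext fun R => propext ?_, funext fun R => propext ?_, ?_⟩
      · have := h₂ (Sum.inl R) none (some ⟨b, hb⟩)
        rwa [hFb] at this
      · have := h₂ (Sum.inl R) (some ⟨b, hb⟩) none
        rwa [hFb] at this
      · rw [hlt]
        have := h₂ (Sum.inr LtSymbol.lt) (some ⟨b, hb⟩) none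
        rwa [hFb] at this

/-- As all symbols are unary or binary, preserving the colours of points and pairs makes a finite
map a partial isomorphism, which ultrahomogeneity extends. -/
theorem isHomogeneousOver_autFixing (hK : IsFreeAmalgamationClass K) (hIrr : IsIrreflexiveClass K)
    (hL : ∀ n, n ≠ 1 → n ≠ 2 → IsEmpty (L.Relations n))
    (hA : IsFraisseLimit (orderedExpansions K) A) (hlt : ∀ a b : A, a < b ↔ ltRel L a b)
    (S : Finset A) :
    (fraisseColoring hK hIrr hL hA hlt).IsHomogeneousOver S (autFixing (withLt L) A S) := by
  have hrel₁ : ∀ (e : A ≃[withLt L] A) (R : (withLt L).Relations 1) x,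
      Structure.RelMap R ![e x] ↔ Structure.RelMap R ![x] := fun e R x => by
    rw [← e.map_rel R ![x], relMap_one_iff R (e ∘ ![x])]
    rfl
  have hrel₂ : ∀ (e : A ≃[withLt L] A) (R : (withLt L).Relations 2) x y,
      Structure.RelMap R ![e x, e y] ↔ Structure.RelMap R ![x, y] := fun e R x y => by
    rw [← e.map_rel R ![x, y], relMap_two_iff R (e ∘ ![x, y])]
    rfl
  refine ⟨fun g hg s hs => hg.2 s hs, ?_, ?_, ?_⟩
  · rintro g ⟨⟨e, he⟩, -⟩ p
    exact funext fun R => propext (by rw [he]; exact hrel₁ e (Sum.inl R) p)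
  · rintro g ⟨⟨e, he⟩, -⟩ p q
    rw [GenericColoring.pair_eq_iff, he, he, hlt, hlt, hlt, hlt]
    exact ⟨funext fun R => propext (hrel₂ e (Sum.inl R) p q),
      funext fun R => propext (hrel₂ e (Sum.inl R) q p), hrel₂ e _ p q, hrel₂ e _ q p⟩
  · intro D γ hSD hγS hγu hγ
    have hpair : ∀ d ∈ D, ∀ d' ∈ D, (fraisseColoring hK hIrr hL hA hlt).pair (γ d) (γ d') =
        (fraisseColoring hK hIrr hL hA hlt).pair d d' := by
      intro d hd d' hd'
      by_cases h : d = d'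
      · subst h
        exact GenericColoring.pair_self _ _
      · exact hγ d hd d' hd' h
    have hfin : Finite (inducedOn (withLt L) (D : Set A)) := D.finite_toSet
    obtain ⟨f, hf⟩ := exists_withLt_embedding_eq (L := L) (M := inducedOn (withLt L) (D : Set A))
      (N := A) hL (fun d => γ d)
      (fun d d' h => Subtype.ext ((GenericColoring.eq_iff_of_pair_eq (hpair d d.2 d' d'.2)).1 h))
      (fun R d => (Iff.of_eq (congrFun (hγu d d.2) R)).trans
        (relMap_inducedOn_one (L := withLt L) (Sum.inl R) d).symm)
      (fun R d d' => (Iff.of_eq (congrFun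
        (GenericColoring.pair_eq_iff.1 (hpair d d.2 d' d'.2)).1 R)).trans
        (relMap_inducedOn_two (L := withLt L) (Sum.inl R) d d').symm)
      (fun d d' => by
        rw [ltRel_inducedOn, ← hlt, ← hlt]
        exact (GenericColoring.pair_eq_iff.1 (hpair d d.2 d' d'.2)).2.2.1)
    obtain ⟨e, he⟩ := hA.ultrahomogeneous _ Substructure.FG.of_finite f
    have hed : ∀ d ∈ D, e d = γ d := by
      intro d hd
      have := DFunLike.congr_fun he (⟨d, hd⟩ : inducedOn (withLt L) (D : Set A))
      rw [hf] at this
      exact this.symm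
    exact ⟨e.toEquiv, ⟨⟨e, fun _ => rfl⟩, fun s hs => (hed s (hSD hs)).trans (hγS s hs)⟩, hed⟩

end Limit

end OrderedFreeAmalgamation

theorem theorem8p3
    -- a finite vocabulary of unary and binary relations
    (L₀ : FirstOrder.Language.{u, v}) [L₀.IsRelational] [Finite (Σ n, L₀.Relations n)]
    (hArity : ∀ n, n ≠ 1 → n ≠ 2 → IsEmpty (L₀.Relations n))
    -- a free amalgamation class of finite irreflexive structures
    (C₀ : Set (Bundled.{w} L₀.Structure))
    (hC₀ : IsFreeAmalgamationClass C₀) (hIrr : IsIrreflexiveClass C₀)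
    -- the Fraïssé limit of all total orderings of its members
    (A : Type w) [(withLt L₀).Structure A] [Countable A]
    (hA : IsFraisseLimit (orderedExpansions C₀) A)
    -- finitely many constants (possibly none), the field, the dimension
    (S : Finset A) (F : Type z) [Field F] (d : ℕ) (hd : 1 ≤ d) :
    -- the finite family of maps from `Lin_F A^d` to `Lin_{F^(n i)}` of the orbit of `o i`
    ∃ (t : ℕ) (k n : Fin t → ℕ) (o : ∀ i, Fin (k i) → A)
      (r : ∀ i, ((Fin d → A) →₀ F) →ₗ[F]
        (MulAction.orbit (autFixing (withLt L₀) A S) (o i) →₀ (Fin (n i) → F))),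
      (∀ i, k i ≤ d) ∧
      (∀ i, IsOrderedTuple L₀ (S : Set A) (o i)) ∧
      (∀ i, IsEquivariantMap (autFixing (withLt L₀) A S) (r i)) ∧
      ∀ W : Submodule F ((Fin d → A) →₀ F),
        IsEquivariantSubspace (autFixing (withLt L₀) A S) W →
        ∃ E : ∀ i, Submodule F (Fin (n i) → F),
          (∀ i, (E i : Set (Fin (n i) → F)) = {x | ∃ w ∈ W, ∃ b, r i w b = x}) ∧
          (W : Set ((Fin d → A) →₀ F)) = {v | ∀ i, ∀ a, r i v a ∈ E i} := by

  have hST := isStrictTotalOrder_of_age hA.age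
  classical
  let _ : LinearOrder A := linearOrderOfSTO (ltRel L₀)
  have hfin : ∀ m, Finite (L₀.Relations m) := fun m =>
    Finite.of_injective (fun R : L₀.Relations m => (⟨m, R⟩ : Σ n, L₀.Relations n))
      sigma_mk_injective
  have hG := isHomogeneousOver_autFixing hC₀ hIrr hArity hA (fun _ _ => Iff.rfl) S
  obtain ⟨t, k, n, o, r, hk, ho, hr, h⟩ := hG.exists_restrictions (F := F) (d := d)
  exact ⟨t, k, n, o, r, hk, fun i => ⟨(ho i).1, fun _ _ hij => (ho i).2 hij⟩, hr, h⟩
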